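/- Let $w\in C^\infty(\mathbb R)$ satisfy $w\ge 0$, $\operatorname{supp} w\subset[1/2,2]$ and $w(s)=1-w(s/2)$ for $s\in[1,2]$. For a tempered distribution $f\in\mathscr S'(\mathbb R)$ and $n\in\mathbb Z$ put $f_n=f*W_n$, where $(\mathscr F W_n)(t)=w(|t|/2^n)$ and $(\mathscr F h)(t)=\int_{\mathbb R}h(x)e^{-ixt}\,dx$. We say that $f$ belongs to the Besov class $B^1_{\infty,1}(\mathbb R)$ if $$\|f\|_{B^1_{\infty,1}}=\sum_{n\in\mathbb Z}2^n\|f_n\|_{L^\infty(\mathbb R)}<\infty\qquad\text{and}\qquad f'=\sum_{n\in\mathbb Z}f_n'\ \text{ in }\mathscr S'(\mathbb R)$$ (weak topology). A continuous function $g:\mathbb R\to\mathbb C$ is called operator Lipschitz if there is a constant $M$ such that $\|g(A)-g(B)\|\le M\|A-B\|$ for all bounded self-adjoint operators $A$ and $B$ on a complex Hilbert space. For a self-adjoint, not necessarily bounded, operator $A$ with spectral measure $E_A$, $g(A)=\int g\,dE_A$ with domain $\{x:\int|g|^2\,d(E_Ax,x)<\infty\}$. For operators $S,T$ we say that $S-T$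 is bounded if $\mathcal D_T\subset\mathcal D_S$ and there is a bounded operator $K$ with $Su-Tu=Ku$ for all $u\in\mathcal D_T$; then $\|S-T\|$ denotes $\|K\|$ (for densely defined $T$). **Theorem.** Let $f\in B^1_{\infty,1}(\mathbb R)$. Then $f$ is (given by) a continuous function, $f$ is operator Lipschitz, and for arbitrary, not necessarily bounded, self-adjoint operators $A$ and $B$ on a complex Hilbert space with bounded difference $A-B$, the operator $f(A)-f(B)$ is bounded and $$\|f(A)-f(B)\|\le C\,\|f\|_{B^1_{\infty,1}}\,\|A-B\|,$$ where $C$ is an absolute constant. -/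

import Mathlib

open MeasureTheory Set
open scoped SchwartzMap ENNReal ContDiff InnerProductSpace

universe u

noncomputable section

/-! ### The Besov class -/

/-- The dyadic windows `w`: smooth, nonnegative, supported in `[1/2, 2]`, and
`w s = 1 - w (s / 2)` on `[1, 2]`, so that `∑ n : ℤ, w (|x| / 2 ^ n) = 1` for `x ≠ 0`. -/
structure IsDyadicWindow (w : ℝ → ℝ) : Prop where
  contDiff : ContDiff ℝ ∞ w
  nonneg : ∀ s, 0 ≤ w s
  tsupport_subset : tsupport w ⊆ Icc (1 / 2) 2
  eq_one_sub : ∀ s ∈ Icc (1 : ℝ) 2, w s = 1 - w (s / 2)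

/-- The symbol of the `n`-th Littlewood-Paley piece. Mathlib's Fourier transform has the kernel
`exp (-2 π i x ξ)`, so the function `t ↦ w (|t| / 2 ^ n)` of the angular frequency `t = 2 π ξ`
becomes the following function of `ξ`. -/
def dyadicSymbol (w : ℝ → ℝ) (n : ℤ) (ξ : ℝ) : ℂ :=
  ((w (|2 * Real.pi * ξ| / (2 : ℝ) ^ n) : ℝ) : ℂ)

/-- The symbol is smooth and compactly supported, hence an admissible Fourier multiplier (the
multiplier operator of Mathlib is `0` for symbols that are not of temperate growth). -/
theorem IsDyadicWindow.hasTemperateGrowth_dyadicSymbol {w : ℝ → ℝ} (hw : IsDyadicWindow w)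
    (n : ℤ) : (dyadicSymbol w n).HasTemperateGrowth := by
  have h2 : (0 : ℝ) < (2 : ℝ) ^ n := by positivity
  have hz : ∀ s : ℝ, s ∉ Icc (1 / 2 : ℝ) 2 → w s = 0 := fun s hs ↦
    image_eq_zero_of_notMem_tsupport fun h ↦ hs (hw.tsupport_subset h)
  have hsm : ContDiff ℝ ∞ (dyadicSymbol w n) := by
    rw [contDiff_iff_contDiffAt]
    intro ξ
    by_cases hξ : ξ = 0
    · subst hξ
      have : dyadicSymbol w n =ᶠ[nhds 0] fun _ ↦ (0 : ℂ) := by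
        have hc : Filter.Tendsto (fun ξ : ℝ ↦ |2 * Real.pi * ξ| / (2 : ℝ) ^ n) (nhds 0)
            (nhds 0) := by
          have : Continuous fun ξ : ℝ ↦ |2 * Real.pi * ξ| / (2 : ℝ) ^ n := by fun_prop
          simpa using this.tendsto 0
        filter_upwards [hc.eventually_lt_const (show (0 : ℝ) < 1 / 2 by norm_num)] with x hx
        simp only [dyadicSymbol]
        rw [hz _ fun h ↦ absurd h.1 (not_le.2 hx), Complex.ofReal_zero]
      exact contDiffAt_const.congr_of_eventuallyEq this
    · have h0 : (2 * Real.pi * ξ) ≠ 0 := by simp [hξ, Real.pi_ne_zero]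
      have h1 : ContDiffAt ℝ ∞ (fun ξ : ℝ ↦ |2 * Real.pi * ξ| / (2 : ℝ) ^ n) ξ :=
        ContDiffAt.div_const
          (ContDiffAt.comp (g := fun y : ℝ ↦ |y|) ξ (contDiffAt_abs h0) (by fun_prop)) _
      exact Complex.ofRealCLM.contDiff.contDiffAt.comp ξ (hw.contDiff.contDiffAt.comp ξ h1)
  have hcs : HasCompactSupport (dyadicSymbol w n) := by
    refine HasCompactSupport.intro (isCompact_closedBall (0 : ℝ) (2 * 2 ^ n)) fun x hx ↦ ?_
    simp only [dyadicSymbol]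
    rw [hz _ fun h ↦ hx ?_, Complex.ofReal_zero]
    have h3 := (div_le_iff₀ h2).1 h.2
    rw [abs_mul, abs_of_pos (by positivity : (0 : ℝ) < 2 * Real.pi)] at h3
    have h4 : |x| ≤ 2 * Real.pi * |x| := by
      nlinarith [abs_nonneg x, Real.pi_gt_three]
    simpa using h4.trans h3
  exact (hcs.toSchwartzMap hsm).hasTemperateGrowth

/-- The Littlewood-Paley piece `f_n = f * W_n` of a tempered distribution `f`: the Fourier
transform of `f` is multiplied by the Fourier transform `w (|·| / 2 ^ n)` of `W_n`. -/
def littlewoodPaley (w : ℝ → ℝ) (n : ℤ) (f : 𝓢'(ℝ, ℂ)) : 𝓢'(ℝ, ℂ) :=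
  TemperedDistribution.fourierMultiplierCLM ℂ (dyadicSymbol w n) f

/-- The `L^∞` norm of a tempered distribution: the essential supremum norm of the bounded function
that represents it, and `∞` if there is no such function. -/
def linftyNorm (S : 𝓢'(ℝ, ℂ)) : ℝ≥0∞ :=
  ⨅ (h : Lp ℂ (⊤ : ℝ≥0∞) (volume : Measure ℝ)) (_ : Lp.toTemperedDistribution h = S), ‖h‖ₑ

/-- The (semi)norm `‖f‖ = ∑ n : ℤ, 2 ^ n ‖f_n‖_{L^∞}` of the Besov class `B^1_{∞,1}(ℝ)`. -/
def besovNorm (w : ℝ → ℝ) (f : 𝓢'(ℝ, ℂ)) : ℝ≥0∞ :=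
  ∑' n : ℤ, (2 : ℝ≥0∞) ^ n * linftyNorm (littlewoodPaley w n f)

/-- Membership in the (modified homogeneous) Besov class `B^1_{∞,1}(ℝ)`: the seminorm is finite
and `f' = ∑ n : ℤ, f_n'` in the space of tempered distributions with its weak topology. -/
structure MemBesov (w : ℝ → ℝ) (f : 𝓢'(ℝ, ℂ)) : Prop where
  norm_ne_top : besovNorm w f ≠ ⊤
  hasSum_deriv : HasSum (fun n : ℤ ↦ TemperedDistribution.derivCLM ℂ (littlewoodPaley w n f))
    (TemperedDistribution.derivCLM ℂ f)

/-- The tempered distribution `f` is given by integration against the function `g`. -/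
def Represents (g : ℝ → ℂ) (f : 𝓢'(ℝ, ℂ)) : Prop :=
  ∀ φ : 𝓢(ℝ, ℂ), Integrable (fun x ↦ φ x * g x) ∧ f φ = ∫ x, φ x * g x

/-! ### Operator Lipschitz functions -/

/-- A continuous function `g` on the real line is operator Lipschitz if
`‖g(A) - g(B)‖ ≤ const ‖A - B‖` for all bounded self-adjoint operators `A` and `B` on a Hilbert
space. Here `g(A)` is the continuous functional calculus, written for the normal element `A`
(whose spectrum is real) since `g` is complex valued. -/
def IsOperatorLipschitz (g : ℝ → ℂ) : Prop :=
  Continuous g ∧ ∃ M : ℝ, ∀ (H : Type u) [NormedAddCommGroup H] [InnerProductSpace ℂ H]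
    [CompleteSpace H] (A B : H →L[ℂ] H), IsSelfAdjoint A → IsSelfAdjoint B →
      ‖cfc (fun z : ℂ ↦ g z.re) A - cfc (fun z : ℂ ↦ g z.re) B‖ ≤ M * ‖A - B‖

/-! ### Functions of unbounded self-adjoint operators -/

section Spectral

variable (H : Type u) [NormedAddCommGroup H] [InnerProductSpace ℂ H] [CompleteSpace H]

/-- A spectral measure on the real line: a projection valued measure on the Borel sets, countably
additive in the strong operator topology. (The values on other sets play no role.) -/
structure SpectralMeasure where
  proj : Set ℝ → H →L[ℂ] H
  isStarProjection : ∀ S, MeasurableSet S → IsStarProjection (proj S)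
  proj_univ : proj univ = 1
  hasSum_proj : ∀ S : ℕ → Set ℝ, (∀ i, MeasurableSet (S i)) →
    Pairwise (fun i j ↦ Disjoint (S i) (S j)) →
    ∀ x, HasSum (fun i ↦ proj (S i) x) (proj (⋃ i, S i) x)

variable {H}

theorem SpectralMeasure.proj_empty (E : SpectralMeasure H) : E.proj ∅ = 0 := by
  ext x
  have h := E.hasSum_proj (fun _ ↦ ∅) (fun _ ↦ MeasurableSet.empty) (fun _ _ _ ↦ by simp) x
  exact tendsto_nhds_unique tendsto_const_nhds h.summable.tendsto_atTop_zero

theorem SpectralMeasure.re_inner_nonneg (E : SpectralMeasure H) {S : Set ℝ}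
    (hS : MeasurableSet S) (x : H) : 0 ≤ (⟪x, E.proj S x⟫_ℂ).re := by
  have h := E.isStarProjection S hS
  have h1 : E.proj S x = E.proj S (E.proj S x) :=
    (DFunLike.congr_fun h.isIdempotentElem.eq x).symm
  have h2 : ⟪x, E.proj S (E.proj S x)⟫_ℂ = ⟪E.proj S x, E.proj S x⟫_ℂ := by
    rw [← ContinuousLinearMap.adjoint_inner_left, h.isSelfAdjoint.adjoint_eq]
  rw [h1, h2]
  exact inner_self_nonneg (𝕜 := ℂ)

/-- The positive measure `S ↦ (E(S) x, x)`. -/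
def SpectralMeasure.scalar (E : SpectralMeasure H) (x : H) : Measure ℝ :=
  Measure.ofMeasurable (fun S _ ↦ ENNReal.ofReal (⟪x, E.proj S x⟫_ℂ).re)
    (by simp [E.proj_empty])
    (by
      intro S hS hd
      have h := ((E.hasSum_proj S hS hd x).mapL (innerSL ℂ x)).mapL Complex.reCLM
      simp only [innerSL_apply_apply, Complex.reCLM_apply] at h
      rw [← h.tsum_eq, ENNReal.ofReal_tsum_of_nonneg
        (fun i ↦ E.re_inner_nonneg (hS i) x) h.summable])

/-- The (possibly unbounded) operator `T` is the integral `∫ g dE`: its domain consists of the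
vectors `x` with `∫ |g|² d(E x, x) < ∞`, and `(T x, x) = ∫ g d(E x, x)` there. As the domain is
a dense linear subspace, polarization shows that there is only one such operator. -/
def IsSpectralIntegral (E : SpectralMeasure H) (g : ℝ → ℂ) (T : H →ₗ.[ℂ] H) : Prop :=
  (∀ x, x ∈ T.domain ↔ MemLp g 2 (E.scalar x)) ∧
    ∀ x : T.domain, ⟪(x : H), T x⟫_ℂ = ∫ t, g t ∂(E.scalar (x : H))

/-- `T = g(A)`: the operator `T` is the integral of `g` with respect to the spectral measure of the
self-adjoint operator `A`, that is, to the spectral measure `E` with `A = ∫ t dE(t)`. -/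
def IsFunctionOf (g : ℝ → ℂ) (A T : H →ₗ.[ℂ] H) : Prop :=
  ∃ E : SpectralMeasure H, IsSpectralIntegral E (fun t ↦ (t : ℂ)) A ∧ IsSpectralIntegral E g T

/-- The difference `A - B` of two operators is bounded and equal to `K`: the domain of `B` is
contained in that of `A`, and `A u - B u = K u` for all `u` in the domain of `B`. -/
def IsBoundedDifference (A B : H →ₗ.[ℂ] H) (K : H →L[ℂ] H) : Prop :=
  ∀ u : B.domain, ∃ hu : (u : H) ∈ A.domain, A ⟨u, hu⟩ - B u = K u

end Spectral

end

/-!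
# Functions of the Besov class `B^1_{∞,1}(ℝ)` are operator Lipschitz

Everything is deduced from Poisson integrals. Let `A` and `B` be self-adjoint with bounded
difference `K`, and let `μ = (E_A u, u)` and `ν = (E_B u, u)` for a vector `u`. The Poisson integral
of `μ` at height `ε` over the point `s` is `(ε / π) ‖a‖²` with `a = (A - s + iε)⁻¹ u`, and likewise
`(ε / π) ‖b‖²` with `b = (B - s - iε)⁻¹ u` for `ν`. By the second resolvent identity
`(a, u) - (u, b) = -(a, K b)`, hence the two Poisson integrals differ by at most `‖K‖ / (2 ε)` times
their sum (`poissonClose_scalar`). Integration over `s` shows that, for a function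
`g(t) = ∫ P_ε(t - s) φ(s) ds` that is itself the Poisson integral of a bounded function,
`|∫ g dμ - ∫ g dν| ≤ (‖K‖ / ε) ‖φ‖_∞ ‖u‖²` (`PoissonClose.norm_integral_sub_le`).

A Littlewood-Paley piece `f_n` is of this form at height `ε = 2⁻ⁿ`. The symbol of the Poisson kernel
is `exp (-2⁻ⁿ |t|)`, and on the annulus `|t| ∼ 2ⁿ` that carries the spectrum of `f_n` its inverse
agrees with a dilate of a fixed test function. So `f_n = P_ε * φ_n` with
`‖φ_n‖_∞ ≤ C₀ ‖f_n‖_∞` (`exists_poissonIntegral_representation`). The condition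
`f' = ∑ f_n'` says that `f` is the sum of the functions `f_n - f_n(0)` up to a constant
(`exists_represents_const_add_poissonSeries`); here one uses that a Schwartz function of mean zero
has a Schwartz primitive. Summing up the estimates with `1 / ε = 2ⁿ` yields
`|∫ f dμ - ∫ f dν| ≤ C₀ ‖f‖ ‖K‖ ‖u‖²`, the property `PoissonLipschitz` of `f`
(`exists_poissonLipschitz_of_memBesov`).

For `u` in the domain of `B` the left-hand side is `|((f(A) - f(B)) u, u)|`, and polarization bounds
`f(A) - f(B)` on that domain at the expense of a factor `2`. Truncations `E_B([-k, k]) u` and the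
closedness of `f(A)` extend the bound to the whole domain of `f(B)`
(`PoissonLipschitz.exists_isBoundedDifference`).

The spectral theorem for unbounded self-adjoint operators is obtained from the continuous functional
calculus of the normal operator `R = (A + i)⁻¹`. A `*`-representation `ρ` of `C(X)` on `H` gives for
each vector `x` a measure on `X`, by the Riesz-Markov-Kakutani theorem, and an isometry of its `L²`
space into `H` that extends `φ ↦ ρ(φ) x`. The images of Borel functions under these isometries are
the Borel functional calculus, and `t ↦ 1 / t - i` transports the measures from the spectrum of `R`
to the line (`IsSelfAdjoint.exists_isCalculus`).
-/

noncomputable section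

/-! ### Poisson integrals of functions and of measures -/

section Poisson

open Filter Topology

/-- The Poisson kernel `ε / (π (x² + ε²))` of the half-plane, at height `ε`. -/
def halfPlaneKernel (ε x : ℝ) : ℝ := ε / (Real.pi * (x ^ 2 + ε ^ 2))

theorem halfPlaneKernel_nonneg {ε : ℝ} (hε : 0 < ε) (x : ℝ) : 0 ≤ halfPlaneKernel ε x := by
  unfold halfPlaneKernel; positivity

theorem continuous_halfPlaneKernel {ε : ℝ} (hε : 0 < ε) : Continuous (halfPlaneKernel ε) := by
  unfold halfPlaneKernel
  refine continuous_const.div (by fun_prop) fun x ↦ ?_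
  positivity

theorem halfPlaneKernel_neg (ε x : ℝ) : halfPlaneKernel ε (-x) = halfPlaneKernel ε x := by
  simp [halfPlaneKernel]

theorem halfPlaneKernel_eq {ε : ℝ} (hε : 0 < ε) (x : ℝ) :
    halfPlaneKernel ε x = (Real.pi * ε)⁻¹ * (1 + (x / ε) ^ 2)⁻¹ := by
  unfold halfPlaneKernel
  field_simp
  ring

theorem integrable_halfPlaneKernel {ε : ℝ} (hε : 0 < ε) : Integrable (halfPlaneKernel ε) := by
  have := (integrable_inv_one_add_sq.comp_div hε.ne').const_mul (Real.pi * ε)⁻¹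
  exact this.congr (Eventually.of_forall fun x ↦ (halfPlaneKernel_eq hε x).symm)

theorem integral_halfPlaneKernel {ε : ℝ} (hε : 0 < ε) : ∫ x, halfPlaneKernel ε x = 1 := by
  simp_rw [halfPlaneKernel_eq hε]
  rw [integral_const_mul, Measure.integral_comp_div (fun x : ℝ ↦ (1 + x ^ 2)⁻¹) ε,
    integral_univ_inv_one_add_sq, abs_of_pos hε, smul_eq_mul]
  field_simp

/-- The Poisson integral of a bounded function at height `ε`. -/
def poissonIntegral (ε : ℝ) (φ : ℝ → ℂ) (x : ℝ) : ℂ := ∫ s, (halfPlaneKernel ε (x - s) : ℂ) * φ s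

/-- The Poisson integral of a finite measure at height `ε`. -/
def poissonMeasure (ε : ℝ) (μ : Measure ℝ) (s : ℝ) : ℝ := ∫ t, halfPlaneKernel ε (t - s) ∂μ

/-- The Poisson integrals of the measures `μ` and `ν` are `k`-close: at each height `ε` they
differ by at most `k / (2 ε)` times their sum. This is what the second resolvent identity gives for
the spectral measures `(E_A u, u)` and `(E_B u, u)` with `k = ‖A - B‖`. -/
def PoissonClose (k : ℝ) (μ ν : Measure ℝ) : Prop :=
  ∀ ε > 0, ∀ s, |poissonMeasure ε μ s - poissonMeasure ε ν s|
    ≤ k / (2 * ε) * (poissonMeasure ε μ s + poissonMeasure ε ν s)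

theorem integrable_halfPlaneKernel_prod {ε : ℝ} (hε : 0 < ε) (μ : Measure ℝ) [IsFiniteMeasure μ] :
    Integrable (fun p : ℝ × ℝ ↦ halfPlaneKernel ε (p.1 - p.2)) (μ.prod volume) := by
  have hm : Continuous fun p : ℝ × ℝ ↦ halfPlaneKernel ε (p.1 - p.2) :=
    (continuous_halfPlaneKernel hε).comp (by fun_prop)
  rw [integrable_prod_iff hm.aestronglyMeasurable]
  have h1 : ∀ t, Integrable fun s ↦ halfPlaneKernel ε (t - s) := fun t ↦
    (integrable_halfPlaneKernel hε).comp_sub_left t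
  have h2 : ∀ t, ∫ s, ‖halfPlaneKernel ε (t - s)‖ = 1 := by
    intro t
    simp_rw [Real.norm_of_nonneg (halfPlaneKernel_nonneg hε _)]
    rw [integral_sub_left_eq_self, integral_halfPlaneKernel hε]
  exact ⟨Eventually.of_forall h1, by simp only [h2]; exact integrable_const _⟩

theorem integral_poissonMeasure {ε : ℝ} (hε : 0 < ε) (μ : Measure ℝ) [IsFiniteMeasure μ] :
    Integrable (poissonMeasure ε μ) ∧ ∫ s, poissonMeasure ε μ s = μ.real univ := by
  have h := integrable_halfPlaneKernel_prod hε μ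
  refine ⟨h.integral_prod_right, ?_⟩
  have h2 := integral_integral_swap (f := fun t s ↦ halfPlaneKernel ε (t - s)) h
  unfold poissonMeasure
  rw [← h2]
  simp_rw [integral_sub_left_eq_self (halfPlaneKernel ε), integral_halfPlaneKernel hε]
  simp

theorem integral_poissonIntegral {ε : ℝ} (hε : 0 < ε) {φ : ℝ → ℂ} {M : ℝ} (hφ : Measurable φ)
    (hM : ∀ s, ‖φ s‖ ≤ M) (μ : Measure ℝ) [IsFiniteMeasure μ] :
    Integrable (poissonIntegral ε φ) μ ∧ Integrable (fun s ↦ (poissonMeasure ε μ s : ℂ) * φ s) ∧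
      ∫ t, poissonIntegral ε φ t ∂μ = ∫ s, (poissonMeasure ε μ s : ℂ) * φ s := by
  have h : Integrable (fun p : ℝ × ℝ ↦ (halfPlaneKernel ε (p.1 - p.2) : ℂ) * φ p.2)
      (μ.prod volume) :=
    (integrable_halfPlaneKernel_prod hε μ).ofReal.mul_bdd (c := M)
      (hφ.comp measurable_snd).aestronglyMeasurable (Eventually.of_forall fun p ↦ hM _)
  have h1 : ∀ s,
      ∫ t, (halfPlaneKernel ε (t - s) : ℂ) * φ s ∂μ = (poissonMeasure ε μ s : ℂ) * φ s := by
    intro s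
    rw [integral_mul_const, integral_complex_ofReal]
    rfl
  have h2 := h.integral_prod_right
  simp only [h1] at h2
  refine ⟨h.integral_prod_left, h2, ?_⟩
  have h3 := integral_integral_swap (f := fun t s ↦ (halfPlaneKernel ε (t - s) : ℂ) * φ s) h
  simp only [h1] at h3
  exact h3

/-- For Poisson-close measures of equal mass the integrals of a Poisson integral differ by at
most `(k / ε) ‖φ‖_∞` times the mass. -/
theorem PoissonClose.norm_integral_sub_le {k : ℝ} {μ ν : Measure ℝ}
    [IsFiniteMeasure μ] [IsFiniteMeasure ν] (h : PoissonClose k μ ν)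
    (hm : μ.real univ = ν.real univ) {ε : ℝ} (hε : 0 < ε) {φ : ℝ → ℂ} {M : ℝ} (hφ : Measurable φ)
    (hM : ∀ s, ‖φ s‖ ≤ M) :
    ‖∫ t, poissonIntegral ε φ t ∂μ - ∫ t, poissonIntegral ε φ t ∂ν‖
      ≤ k / ε * M * μ.real univ := by
  obtain ⟨-, i1, e1⟩ := integral_poissonIntegral hε hφ hM μ
  obtain ⟨-, i2, e2⟩ := integral_poissonIntegral hε hφ hM ν
  obtain ⟨j1, f1⟩ := integral_poissonMeasure hε μ
  obtain ⟨j2, f2⟩ := integral_poissonMeasure hε ν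
  have hM0 : 0 ≤ M := (norm_nonneg _).trans (hM 0)
  rw [e1, e2, ← integral_sub i1 i2]
  have hb : ∀ s, ‖(poissonMeasure ε μ s : ℂ) * φ s - (poissonMeasure ε ν s : ℂ) * φ s‖
      ≤ k / (2 * ε) * M * (poissonMeasure ε μ s + poissonMeasure ε ν s) := by
    intro s
    rw [← sub_mul, norm_mul, ← Complex.ofReal_sub, Complex.norm_real, Real.norm_eq_abs,
      mul_right_comm]
    exact mul_le_mul (h ε hε s) (hM s) (norm_nonneg _) ((abs_nonneg _).trans (h ε hε s))
  refine (norm_integral_le_of_norm_le ((j1.add j2).const_mul _) (Eventually.of_forall hb)).trans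
    (le_of_eq ?_)
  simp only [Pi.add_apply]
  rw [integral_const_mul, integral_add j1 j2, f1, f2, ← hm]
  field_simp
  ring

theorem poissonMeasure_dirac (ε x s : ℝ) :
    poissonMeasure ε (Measure.dirac x) s = halfPlaneKernel ε (x - s) := by
  simp [poissonMeasure]

/-- With `PoissonClose.norm_integral_sub_le`, this makes pointwise Lipschitz estimates a special
case of the estimates for integrals. -/
theorem poissonClose_dirac (x y : ℝ) :
    PoissonClose |x - y| (Measure.dirac x) (Measure.dirac y) := by
  intro ε hε s
  rw [poissonMeasure_dirac, poissonMeasure_dirac]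
  unfold halfPlaneKernel
  set p := x - s with hp
  set q := y - s with hq
  have hxy : x - y = p - q := by rw [hp, hq]; ring
  rw [hxy]
  have hP : 0 < p ^ 2 + ε ^ 2 := by positivity
  have hQ : 0 < q ^ 2 + ε ^ 2 := by positivity
  have e1 : ε / (Real.pi * (p ^ 2 + ε ^ 2)) - ε / (Real.pi * (q ^ 2 + ε ^ 2))
      = (p - q) * (-(2 * ε * (p + q))) / (2 * (Real.pi * (p ^ 2 + ε ^ 2) * (q ^ 2 + ε ^ 2))) := by
    field_simp
    ring
  have e2 : |p - q| / (2 * ε) * (ε / (Real.pi * (p ^ 2 + ε ^ 2)) + ε / (Real.pi * (q ^ 2 + ε ^ 2)))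
      = |p - q| * (p ^ 2 + ε ^ 2 + (q ^ 2 + ε ^ 2))
        / (2 * (Real.pi * (p ^ 2 + ε ^ 2) * (q ^ 2 + ε ^ 2))) := by
    field_simp
    ring
  rw [e1, e2, abs_div, abs_mul, abs_of_pos (by positivity :
    0 < 2 * (Real.pi * (p ^ 2 + ε ^ 2) * (q ^ 2 + ε ^ 2)))]
  gcongr
  rw [abs_neg, abs_le]
  constructor <;> nlinarith [sq_nonneg (p - ε), sq_nonneg (p + ε), sq_nonneg (q - ε),
    sq_nonneg (q + ε)]

theorem norm_poissonIntegral_sub_le {ε : ℝ} (hε : 0 < ε) {φ : ℝ → ℂ} {M : ℝ} (hφ : Measurable φ)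
    (hM : ∀ s, ‖φ s‖ ≤ M) (x y : ℝ) :
    ‖poissonIntegral ε φ x - poissonIntegral ε φ y‖ ≤ M / ε * |x - y| := by
  have h := (poissonClose_dirac x y).norm_integral_sub_le (by simp) hε hφ hM
  rw [integral_dirac, integral_dirac] at h
  refine h.trans (le_of_eq ?_)
  simp
  ring

theorem continuous_poissonIntegral {ε : ℝ} (hε : 0 < ε) {φ : ℝ → ℂ} {M : ℝ} (hφ : Measurable φ)
    (hM : ∀ s, ‖φ s‖ ≤ M) : Continuous (poissonIntegral ε φ) :=
  (LipschitzWith.of_dist_le' (K := M / ε) fun x y ↦ by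
    rw [dist_eq_norm, dist_eq_norm]
    exact norm_poissonIntegral_sub_le hε hφ hM x y).continuous

theorem norm_poissonIntegral_le {ε : ℝ} (hε : 0 < ε) {φ : ℝ → ℂ} {M : ℝ}
    (hM : ∀ s, ‖φ s‖ ≤ M) (x : ℝ) : ‖poissonIntegral ε φ x‖ ≤ M := by
  have hi : Integrable fun s ↦ halfPlaneKernel ε (x - s) * M :=
    ((integrable_halfPlaneKernel hε).comp_sub_left x).mul_const M
  refine (norm_integral_le_of_norm_le hi (Eventually.of_forall fun s ↦ ?_)).trans (le_of_eq ?_)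
  · rw [norm_mul, Complex.norm_real, Real.norm_of_nonneg (halfPlaneKernel_nonneg hε _)]
    exact mul_le_mul_of_nonneg_left (hM s) (halfPlaneKernel_nonneg hε _)
  · rw [integral_mul_const, integral_sub_left_eq_self (halfPlaneKernel ε),
      integral_halfPlaneKernel hε, one_mul]

end Poisson

/-! ### The Fourier transform of the Poisson kernel -/

section PoissonFourier

open Filter Topology
open scoped FourierTransform

theorem integrable_mul_comp_sub {κ G : ℝ → ℂ} (hκ : Integrable κ) (hG : Integrable G) :
    Integrable (fun p : ℝ × ℝ ↦ κ (p.2 - p.1) * G p.2) (volume.prod volume) := by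
  have h := hG.convolution_integrand (ContinuousLinearMap.mul ℂ ℂ) hκ.comp_neg
  refine h.congr (Eventually.of_forall fun p ↦ ?_)
  simp [mul_comm]

/-- The transpose of convolution with `κ`, for an integrable `G` and a bounded `h`. -/
theorem integral_convolution_mul {κ G h : ℝ → ℂ} {M : ℝ} (hκ : Integrable κ) (hG : Integrable G)
    (hh : Measurable h) (hM : ∀ᵐ y, ‖h y‖ ≤ M) :
    Integrable (fun y ↦ ∫ s, κ (s - y) * G s) ∧
    ∫ y, (∫ s, κ (s - y) * G s) * h y = ∫ s, G s * ∫ y, κ (s - y) * h y := by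
  have h0 := integrable_mul_comp_sub hκ hG
  refine ⟨h0.integral_prod_left, ?_⟩
  have h1 : Integrable (fun p : ℝ × ℝ ↦ κ (p.2 - p.1) * G p.2 * h p.1) (volume.prod volume) := by
    refine h0.mul_bdd (c := M) (hh.comp measurable_fst).aestronglyMeasurable ?_
    exact Measure.quasiMeasurePreserving_fst.ae hM
  have h2 := integral_integral_swap (f := fun y s ↦ κ (s - y) * G s * h y) h1
  simp_rw [integral_mul_const] at h2
  rw [h2]
  refine integral_congr_ae (Eventually.of_forall fun s ↦ ?_)
  simp only
  rw [← integral_const_mul]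
  congr 1; ext y; ring

theorem integral_mul_fourier_add {a b : ℝ → ℂ} (ha : Integrable a) (hb : Integrable b) (y : ℝ) :
    ∫ s, a s * 𝓕 b (s + y) = 𝓕 (fun ξ ↦ 𝓕 a ξ * b ξ) y := by
  have h1 : Integrable (fun p : ℝ × ℝ ↦
      Complex.exp (((-2 * Real.pi * p.2 * (p.1 + y) : ℝ) : ℂ) * Complex.I) * (a p.1 * b p.2))
      (volume.prod volume) := by
    refine (ha.mul_prod hb).bdd_mul (c := 1) (by fun_prop) (Eventually.of_forall fun p ↦ ?_)
    rw [Complex.norm_exp_ofReal_mul_I]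
  have h2 := integral_integral_swap (f := fun s ξ ↦
      Complex.exp (((-2 * Real.pi * ξ * (s + y) : ℝ) : ℂ) * Complex.I) * (a s * b ξ)) h1
  calc ∫ s, a s * 𝓕 b (s + y)
      = ∫ s, ∫ ξ, Complex.exp (((-2 * Real.pi * ξ * (s + y) : ℝ) : ℂ) * Complex.I)
          * (a s * b ξ) := by
        congr 1; ext s
        rw [Real.fourier_real_eq_integral_exp_smul, ← integral_const_mul]
        congr 1; ext ξ
        rw [smul_eq_mul]; ring
    _ = ∫ ξ, ∫ s, Complex.exp (((-2 * Real.pi * ξ * (s + y) : ℝ) : ℂ) * Complex.I)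
          * (a s * b ξ) := h2
    _ = 𝓕 (fun ξ ↦ 𝓕 a ξ * b ξ) y := by
        rw [Real.fourier_real_eq_integral_exp_smul]
        congr 1; ext ξ
        rw [Real.fourier_real_eq_integral_exp_smul, smul_eq_mul, ← integral_mul_const,
          ← integral_const_mul]
        congr 1; ext s
        have e : Complex.exp (((-2 * Real.pi * ξ * (s + y) : ℝ) : ℂ) * Complex.I)
            = Complex.exp (((-2 * Real.pi * ξ * y : ℝ) : ℂ) * Complex.I)
              * Complex.exp (((-2 * Real.pi * s * ξ : ℝ) : ℂ) * Complex.I) := by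
          rw [← Complex.exp_add]
          congr 1; push_cast; ring
        rw [e, smul_eq_mul]; ring

/-- The symbol `exp (-|t| ε)` of the Poisson kernel, in the variable `ξ` with `t = 2 π ξ`. -/
def halfPlaneSymbol (ε ξ : ℝ) : ℂ := (Real.exp (-(2 * Real.pi * ε) * |ξ|) : ℝ)

theorem continuous_halfPlaneSymbol (ε : ℝ) : Continuous (halfPlaneSymbol ε) := by
  unfold halfPlaneSymbol; fun_prop

theorem norm_halfPlaneSymbol_le {ε : ℝ} (hε : 0 < ε) (ξ : ℝ) : ‖halfPlaneSymbol ε ξ‖ ≤ 1 := by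
  unfold halfPlaneSymbol
  rw [Complex.norm_real, Real.norm_of_nonneg (Real.exp_pos _).le, Real.exp_le_one_iff]
  have := Real.pi_pos
  have : 0 ≤ 2 * Real.pi * ε * |ξ| := by positivity
  linarith

theorem integrable_halfPlaneSymbol {ε : ℝ} (hε : 0 < ε) : Integrable (halfPlaneSymbol ε) := by
  have hc : 0 < 2 * Real.pi * ε := by positivity
  have h : Integrable fun ξ : ℝ ↦ Real.exp (-(2 * Real.pi * ε) * |ξ|) := by
    rw [← integrableOn_univ, ← Iic_union_Ioi (a := (0 : ℝ))]
    refine IntegrableOn.union ?_ ?_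
    · refine (integrableOn_exp_mul_Iic hc 0).congr_fun (fun x hx ↦ ?_) measurableSet_Iic
      simp only [abs_of_nonpos (mem_Iic.1 hx)]
      ring_nf
    · refine (integrableOn_exp_mul_Ioi (neg_lt_zero.2 hc) 0).congr_fun (fun x hx ↦ ?_)
        measurableSet_Ioi
      simp only [abs_of_pos (mem_Ioi.1 hx)]
  exact h.ofReal

theorem fourierInv_halfPlaneSymbol {ε : ℝ} (hε : 0 < ε) :
    𝓕⁻ (halfPlaneSymbol ε) = fun x ↦ (halfPlaneKernel ε x : ℂ) := by
  have hpi := Real.pi_pos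
  ext x
  rw [Real.fourierInv_eq_fourier_neg, Real.fourier_real_eq_integral_exp_smul]
  let a : ℂ := 2 * Real.pi * x * Complex.I
  let c : ℂ := 2 * Real.pi * ε
  have hc : c.re = 2 * Real.pi * ε := by simp [c]
  have ha : a.re = 0 := by simp [a]
  have e1 : ∀ v ∈ Ioi (0 : ℝ), Complex.exp (((-2 * Real.pi * v * -x : ℝ) : ℂ) * Complex.I)
      • halfPlaneSymbol ε v = Complex.exp ((a - c) * v) := by
    intro v hv
    rw [halfPlaneSymbol, abs_of_pos hv, smul_eq_mul, Complex.ofReal_exp, ← Complex.exp_add]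
    congr 1; simp only [a, c]; push_cast; ring
  have e2 : ∀ v ∈ Iic (0 : ℝ), Complex.exp (((-2 * Real.pi * v * -x : ℝ) : ℂ) * Complex.I)
      • halfPlaneSymbol ε v = Complex.exp ((a + c) * v) := by
    intro v hv
    rw [halfPlaneSymbol, abs_of_nonpos hv, smul_eq_mul, Complex.ofReal_exp, ← Complex.exp_add]
    congr 1; simp only [a, c]; push_cast; ring
  have hpos : 0 < 2 * Real.pi * ε := by positivity
  have n1 : (a - c).re < 0 := by rw [Complex.sub_re, ha, hc]; linarith
  have n2 : 0 < (a + c).re := by rw [Complex.add_re, ha, hc]; linarith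
  have i1 := (integrableOn_exp_mul_complex_Ioi n1 0).congr_fun (fun v hv ↦ (e1 v hv).symm)
    measurableSet_Ioi
  have i2 := (integrableOn_exp_mul_complex_Iic n2 0).congr_fun (fun v hv ↦ (e2 v hv).symm)
    measurableSet_Iic
  rw [← intervalIntegral.integral_Iic_add_Ioi i2 i1, setIntegral_congr_fun measurableSet_Ioi e1,
    setIntegral_congr_fun measurableSet_Iic e2, integral_exp_mul_complex_Ioi n1,
    integral_exp_mul_complex_Iic n2]
  have hne1 : a - c ≠ 0 := fun h ↦ by rw [h] at n1; simp at n1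
  have hne2 : a + c ≠ 0 := fun h ↦ by rw [h] at n2; simp at n2
  have hx : ((x : ℂ) ^ 2 + (ε : ℂ) ^ 2) ≠ 0 := by
    norm_cast; positivity
  have hpi' : (Real.pi : ℂ) ≠ 0 := by exact_mod_cast hpi.ne'
  simp only [Complex.ofReal_zero, mul_zero, Complex.exp_zero, halfPlaneKernel]
  push_cast
  rw [div_add_div _ _ hne2 hne1, div_eq_div_iff (mul_ne_zero hne2 hne1) (mul_ne_zero hpi' hx)]
  simp only [a, c]
  ring_nf
  simp only [Complex.I_sq]
  ring

theorem fourier_halfPlaneKernel {ε : ℝ} (hε : 0 < ε) :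
    𝓕 (fun x ↦ (halfPlaneKernel ε x : ℂ)) = halfPlaneSymbol ε := by
  rw [← fourierInv_halfPlaneSymbol hε]
  refine Continuous.fourier_fourierInv_eq (continuous_halfPlaneSymbol ε)
    (integrable_halfPlaneSymbol hε) ?_
  have h : 𝓕 (halfPlaneSymbol ε) = fun x ↦ (halfPlaneKernel ε x : ℂ) := by
    ext x
    have := congrFun (fourierInv_halfPlaneSymbol hε) (-x)
    rwa [Real.fourierInv_eq_fourier_neg, neg_neg, halfPlaneKernel_neg] at this
  rw [h]
  exact (integrable_halfPlaneKernel hε).ofReal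

/-- Convolution with the Poisson kernel followed by convolution with `𝓕⁻ Q` is the Fourier
multiplier with symbol `exp (-|t| ε) Q`. -/
theorem integral_fourierInv_mul_poisson {ε : ℝ} (hε : 0 < ε) (Q ψ : 𝓢(ℝ, ℂ)) (y : ℝ) :
    ∫ s, 𝓕⁻ (Q : ℝ → ℂ) (s - y) * ∫ x, (halfPlaneKernel ε (x - s) : ℂ) * ψ x
      = 𝓕 (fun ξ ↦ Q ξ * (halfPlaneSymbol ε ξ * 𝓕⁻ (ψ : ℝ → ℂ) ξ)) y := by
  have hinv : ∀ χ : 𝓢(ℝ, ℂ), 𝓕 (𝓕⁻ (χ : ℝ → ℂ)) = χ := fun χ ↦ by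
    rw [← SchwartzMap.fourierInv_coe, ← SchwartzMap.fourier_coe,
      FourierTransform.fourier_fourierInv_eq]
  have iψ : Integrable (𝓕⁻ (ψ : ℝ → ℂ)) := by
    rw [← SchwartzMap.fourierInv_coe]; exact SchwartzMap.integrable _
  have iQ : Integrable (𝓕⁻ (Q : ℝ → ℂ)) := by
    rw [← SchwartzMap.fourierInv_coe]; exact SchwartzMap.integrable _
  have h1 : ∀ s, ∫ x, (halfPlaneKernel ε (x - s) : ℂ) * ψ x
      = 𝓕 (fun ξ ↦ halfPlaneSymbol ε ξ * 𝓕⁻ (ψ : ℝ → ℂ) ξ) s := by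
    intro s
    have iP : Integrable fun x ↦ (halfPlaneKernel ε x : ℂ) := (integrable_halfPlaneKernel hε).ofReal
    have h := integral_mul_fourier_add iP iψ s
    rw [fourier_halfPlaneKernel hε, hinv] at h
    rw [← h, ← integral_sub_right_eq_self (fun x ↦ (halfPlaneKernel ε x : ℂ) * ψ (x + s)) s]
    simp
  simp_rw [h1]
  have i2 : Integrable (fun ξ ↦ halfPlaneSymbol ε ξ * 𝓕⁻ (ψ : ℝ → ℂ) ξ) :=
    iψ.bdd_mul (c := 1) (continuous_halfPlaneSymbol ε).aestronglyMeasurable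
      (Eventually.of_forall (norm_halfPlaneSymbol_le hε))
  have h := integral_mul_fourier_add iQ i2 y
  rw [hinv] at h
  rw [← h, ← integral_sub_right_eq_self (fun s ↦ 𝓕⁻ (Q : ℝ → ℂ) s * _) y]
  simp

end PoissonFourier

/-! ### Littlewood-Paley pieces as Poisson integrals -/

section PieceRepresentation

open Filter Topology
open scoped FourierTransform

/-- There are test functions `m` and `q` with `m = 1` on the dyadic annulus `1/2 ≤ |t| ≤ 2` and
`q t * exp (-|t|) = m t`: since `m` vanishes near `0`, the factor `exp |t|` is smooth on its
support. -/
theorem exists_annulus_multiplier : ∃ q m : ℝ → ℂ, ContDiff ℝ ∞ q ∧ HasCompactSupport q ∧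
    ContDiff ℝ ∞ m ∧ HasCompactSupport m ∧ (∀ t, q t * (Real.exp (-|t|) : ℝ) = m t) ∧
    ∀ t, |t| ∈ Icc (1 / 2 : ℝ) 2 → m t = 1 := by
  let v : ContDiffBump (5 / 4 : ℝ) := ⟨3 / 4, 1, by norm_num, by norm_num⟩
  have hv0 : ∀ t ≤ 0, v t = 0 := by
    intro t ht
    refine v.zero_of_le_dist ?_
    rw [Real.dist_eq, abs_of_nonpos (by linarith)]
    simp only [v]; linarith
  have hv1 : ∀ t ∈ Icc (1 / 2 : ℝ) 2, v t = 1 := by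
    intro t ht
    refine v.one_of_mem_closedBall ?_
    rw [mem_closedBall_iff_norm, Real.norm_eq_abs, abs_le]
    simp only [v]
    constructor <;> linarith [ht.1, ht.2]
  have hvs : ContDiff ℝ ∞ (v : ℝ → ℝ) := v.contDiff
  have hcs : ∀ t, 9 / 4 ≤ |t| → v t = 0 ∧ v (-t) = 0 := by
    intro t ht
    rcases le_abs'.1 ht with h | h
    · refine ⟨hv0 t (by linarith), v.zero_of_le_dist ?_⟩
      rw [Real.dist_eq, abs_of_nonneg (by linarith)]
      simp only [v]; linarith
    · refine ⟨v.zero_of_le_dist ?_, hv0 _ (by linarith)⟩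
      rw [Real.dist_eq, abs_of_nonneg (by linarith)]
      simp only [v]; linarith
  have hvn : ContDiff ℝ ∞ (fun t ↦ v (-t)) := hvs.comp contDiff_neg
  have hq : ContDiff ℝ ∞ fun t ↦ v t * Real.exp t + v (-t) * Real.exp (-t) :=
    (hvs.mul Real.contDiff_exp).add (hvn.mul (Real.contDiff_exp.comp contDiff_neg))
  refine ⟨fun t ↦ ((v t * Real.exp t + v (-t) * Real.exp (-t) : ℝ) : ℂ),
    fun t ↦ ((v t + v (-t) : ℝ) : ℂ), ?_, ?_, ?_, ?_, fun t ↦ ?_, fun t ht ↦ ?_⟩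
  · exact Complex.ofRealCLM.contDiff.comp hq
  · refine HasCompactSupport.intro (isCompact_closedBall (0 : ℝ) (9 / 4)) fun t ht ↦ ?_
    rw [mem_closedBall_zero_iff, Real.norm_eq_abs, not_le] at ht
    simp [hcs t ht.le]
  · exact Complex.ofRealCLM.contDiff.comp (hvs.add hvn)
  · refine HasCompactSupport.intro (isCompact_closedBall (0 : ℝ) (9 / 4)) fun t ht ↦ ?_
    rw [mem_closedBall_zero_iff, Real.norm_eq_abs, not_le] at ht
    simp [hcs t ht.le]
  · rw [← Complex.ofReal_mul]
    congr 1
    rcases le_total t 0 with h | h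
    · rw [hv0 t h, abs_of_nonpos h, zero_mul, zero_add, zero_add, mul_assoc, ← Real.exp_add]
      simp
    · rw [hv0 (-t) (by linarith), abs_of_nonneg h, zero_mul, add_zero, add_zero, mul_assoc,
        ← Real.exp_add]
      simp
  · rcases le_total t 0 with h | h
    · rw [abs_of_nonpos h] at ht
      simp [hv0 t h, hv1 _ ht]
    · rw [abs_of_nonneg h] at ht
      simp [hv0 (-t) (by linarith), hv1 _ ht]

/-- The `L¹` norm of the inverse Fourier transform is invariant under dilation of the symbol. -/
theorem integral_norm_fourierInv_comp_mul {b : ℝ} (hb : 0 < b) (q : ℝ → ℂ) :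
    ∫ x, ‖𝓕⁻ (fun ξ ↦ q (b * ξ)) x‖ = ∫ x, ‖𝓕⁻ q x‖ := by
  have h : ∀ x, 𝓕⁻ (fun ξ ↦ q (b * ξ)) x = b⁻¹ • 𝓕⁻ q (b⁻¹ * x) := by
    intro x
    rw [Real.fourierInv_eq', Real.fourierInv_eq']
    have := Measure.integral_comp_mul_left (fun v : ℝ ↦
      Complex.exp (((2 * Real.pi * inner ℝ v (b⁻¹ * x) : ℝ) : ℂ) * Complex.I) • q v) b
    rw [abs_of_pos (inv_pos.2 hb)] at this
    rw [← this]
    congr 1; ext v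
    congr 5
    simp only [RCLike.inner_apply, conj_trivial]
    field_simp
  simp_rw [h, norm_smul]
  rw [integral_const_mul, Measure.integral_comp_mul_left (fun x ↦ ‖𝓕⁻ q x‖), inv_inv,
    abs_of_pos hb, Real.norm_of_nonneg (inv_pos.2 hb).le, smul_eq_mul, ← mul_assoc,
    inv_mul_cancel₀ hb.ne', one_mul]

theorem exists_schwartzMap_comp_mul {b : ℝ} (hb : b ≠ 0) {q : ℝ → ℂ} (hq : ContDiff ℝ ∞ q)
    (hc : HasCompactSupport q) : ∃ Q : 𝓢(ℝ, ℂ), (Q : ℝ → ℂ) = fun ξ ↦ q (b * ξ) :=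
  ⟨HasCompactSupport.toSchwartzMap (hc.comp_homeomorph (Homeomorph.mulLeft₀ b hb))
    (hq.comp (contDiff_const.mul contDiff_id)), rfl⟩

/-- A distribution with finite `L^∞` norm is given by a measurable function with that bound. -/
theorem exists_measurable_of_linftyNorm_ne_top {S : 𝓢'(ℝ, ℂ)} (hS : linftyNorm S ≠ ⊤) :
    ∃ h : ℝ → ℂ, Measurable h ∧ (∀ᵐ y, ‖h y‖ ≤ (linftyNorm S).toReal) ∧
      ∀ u : 𝓢(ℝ, ℂ), S u = ∫ y, u y * h y := by
  have h1 : linftyNorm S < ⊤ := lt_top_iff_ne_top.2 hS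
  unfold linftyNorm at h1
  simp only [iInf_lt_iff] at h1
  obtain ⟨h, hh, -⟩ := h1
  have hinj : Function.Injective (Lp.toTemperedDistributionCLM ℂ (volume : Measure ℝ) ⊤) :=
    LinearMap.ker_eq_bot.1 Lp.ker_toTemperedDistributionCLM_eq_bot
  have hle : ‖h‖ₑ ≤ linftyNorm S := by
    refine le_iInf₂ fun h' hh' ↦ ?_
    have : h = h' := hinj (by
      rw [Lp.toTemperedDistributionCLM_apply, Lp.toTemperedDistributionCLM_apply, hh, hh'])
    rw [this]
  refine ⟨h, (Lp.stronglyMeasurable h).measurable, ?_, fun u ↦ ?_⟩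
  · filter_upwards [enorm_ae_le_eLpNormEssSup h volume] with y hy
    have h2 : ‖h y‖ₑ ≤ linftyNorm S := by
      refine hy.trans (le_trans (le_of_eq ?_) hle)
      rw [Lp.enorm_def, eLpNorm_exponent_top]
    have h3 := ENNReal.toReal_mono hS h2
    rwa [toReal_enorm] at h3
  · rw [← hh, Lp.toTemperedDistribution_apply]
    simp only [smul_eq_mul]

/-- The annular multiplier acts as the identity on a Littlewood-Paley piece. -/
theorem littlewoodPaley_fourier_smulLeft {w : ℝ → ℝ} (hw : IsDyadicWindow w) (f : 𝓢'(ℝ, ℂ)) (n : ℤ)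
    {M ψ θ : 𝓢(ℝ, ℂ)} (hM : ∀ ξ, dyadicSymbol w n ξ ≠ 0 → M ξ = 1)
    (hθ : ∀ ξ, θ ξ = M ξ * 𝓕⁻ ψ ξ) :
    littlewoodPaley w n f (𝓕 θ) = littlewoodPaley w n f ψ := by
  unfold littlewoodPaley
  rw [TemperedDistribution.fourierMultiplierCLM_apply_apply,
    TemperedDistribution.fourierMultiplierCLM_apply_apply]
  congr 2
  ext ξ
  have hg := hw.hasTemperateGrowth_dyadicSymbol n
  rw [SchwartzMap.smulLeftCLM_apply_apply hg, SchwartzMap.smulLeftCLM_apply_apply hg,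
    FourierTransform.fourierInv_fourier_eq, hθ, smul_eq_mul, smul_eq_mul]
  by_cases h : dyadicSymbol w n ξ = 0
  · simp [h]
  · rw [hM ξ h, one_mul]

/-- The `n`-th Littlewood-Paley piece is the Poisson integral, at height `2⁻ⁿ`, of a bounded
function `φ`. Indeed the symbol of the piece lives where `|t| ∼ 2ⁿ`, and there the symbol
`exp (-2⁻ⁿ |t|)` of the Poisson kernel has an inverse that is a bounded multiplier. -/
theorem exists_poissonIntegral_representation : ∃ C₀ : ℝ, 0 ≤ C₀ ∧ ∀ w : ℝ → ℝ, IsDyadicWindow w →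
    ∀ (f : 𝓢'(ℝ, ℂ)) (n : ℤ), linftyNorm (littlewoodPaley w n f) ≠ ⊤ →
      ∃ φ : ℝ → ℂ, Measurable φ ∧
        (∀ s, ‖φ s‖ ≤ C₀ * (linftyNorm (littlewoodPaley w n f)).toReal) ∧
        Represents (poissonIntegral ((2 : ℝ) ^ (-n)) φ) (littlewoodPaley w n f) := by
  obtain ⟨q, m, hq, hqc, hm, hmc, hqm, hm1⟩ := exists_annulus_multiplier
  refine ⟨∫ x, ‖𝓕⁻ q x‖, by positivity, fun w hw f n hfin ↦ ?_⟩
  have hpi := Real.pi_pos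
  set ε : ℝ := (2 : ℝ) ^ (-n) with hεdef
  have hε : 0 < ε := by positivity
  have hb : 0 < 2 * Real.pi * ε := by positivity
  -- In terms of the angular frequency `t = 2 π ξ` the multipliers are functions of `t / 2ⁿ`.
  obtain ⟨Q, hQ⟩ := exists_schwartzMap_comp_mul hb.ne' hq hqc
  obtain ⟨M, hM⟩ := exists_schwartzMap_comp_mul hb.ne' hm hmc
  obtain ⟨h, hmeas, hbd, hrep⟩ := exists_measurable_of_linftyNorm_ne_top hfin
  set B := (linftyNorm (littlewoodPaley w n f)).toReal
  let κ : ℝ → ℂ := 𝓕⁻ (Q : ℝ → ℂ)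
  have hκ : κ = (𝓕⁻ Q : 𝓢(ℝ, ℂ)) := by rw [SchwartzMap.fourierInv_coe]
  have iκ : Integrable κ := by rw [hκ]; exact SchwartzMap.integrable _
  have mκ : Continuous κ := by rw [hκ]; exact SchwartzMap.continuous _
  have nκ : ∫ x, ‖κ x‖ = ∫ x, ‖𝓕⁻ q x‖ := by
    simp only [κ, hQ]
    exact integral_norm_fourierInv_comp_mul hb q
  let φ : ℝ → ℂ := fun s ↦ ∫ y, κ (s - y) * h y
  have mφ : Measurable φ := by
    refine StronglyMeasurable.measurable (StronglyMeasurable.integral_prod_right'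
      (f := fun p : ℝ × ℝ ↦ κ (p.1 - p.2) * h p.2) (Measurable.stronglyMeasurable ?_))
    exact (mκ.measurable.comp (measurable_fst.sub measurable_snd)).mul (hmeas.comp measurable_snd)
  have bφ : ∀ s, ‖φ s‖ ≤ (∫ x, ‖𝓕⁻ q x‖) * B := by
    intro s
    have hi : Integrable fun y ↦ ‖κ (s - y)‖ * B := (iκ.norm.comp_sub_left s).mul_const B
    refine (norm_integral_le_of_norm_le hi ?_).trans (le_of_eq ?_)
    · filter_upwards [hbd] with y hy
      rw [norm_mul]
      gcongr
    · rw [integral_mul_const, integral_sub_left_eq_self (fun x ↦ ‖κ x‖), nκ]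
  refine ⟨φ, mφ, bφ, fun ψ ↦ ?_⟩
  have iP : Integrable fun x ↦ (halfPlaneKernel ε x : ℂ) := (integrable_halfPlaneKernel hε).ofReal
  obtain ⟨iG, eG⟩ := integral_convolution_mul iP ψ.integrable mφ (Eventually.of_forall bφ)
  refine ⟨?_, ?_⟩
  · exact ψ.integrable.mul_bdd
      (continuous_poissonIntegral hε mφ bφ).aestronglyMeasurable
      (Eventually.of_forall (norm_poissonIntegral_le hε bφ))
  have key := (integral_convolution_mul iκ iG hmeas hbd).2
  let θ : 𝓢(ℝ, ℂ) := SchwartzMap.smulLeftCLM ℂ (M : ℝ → ℂ) (𝓕⁻ ψ)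
  have hθ : ∀ ξ, θ ξ = M ξ * 𝓕⁻ ψ ξ := fun ξ ↦
    SchwartzMap.smulLeftCLM_apply_apply M.hasTemperateGrowth _ _
  have hMsym : ∀ ξ, dyadicSymbol w n ξ ≠ 0 → M ξ = 1 := by
    intro ξ hξ
    rw [hM]
    refine hm1 _ ?_
    have h1 : w (|2 * Real.pi * ξ| / (2 : ℝ) ^ n) ≠ 0 := fun h0 ↦ hξ (by
      simp only [dyadicSymbol, h0, Complex.ofReal_zero])
    have h2 := hw.tsupport_subset (subset_tsupport _ h1)
    have h3 : |2 * Real.pi * ε * ξ| = |2 * Real.pi * ξ| / (2 : ℝ) ^ n := by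
      rw [mul_right_comm, abs_mul, abs_of_pos hε, hεdef, zpow_neg, div_eq_mul_inv]
    rwa [h3]
  have hQM : ∀ ξ, Q ξ * halfPlaneSymbol ε ξ = M ξ := by
    intro ξ
    rw [hQ, hM]
    simp only
    rw [← hqm, halfPlaneSymbol, abs_mul, abs_of_pos hb, neg_mul]
  rw [← littlewoodPaley_fourier_smulLeft hw f n hMsym hθ, hrep]
  have hF : ∀ y, (𝓕 θ : 𝓢(ℝ, ℂ)) y
      = ∫ s, κ (s - y) * ∫ x, (halfPlaneKernel ε (x - s) : ℂ) * ψ x := by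
    intro y
    have hθ' : (θ : ℝ → ℂ) = fun ξ ↦ Q ξ * (halfPlaneSymbol ε ξ * 𝓕⁻ (ψ : ℝ → ℂ) ξ) := by
      funext ξ
      rw [hθ, ← hQM, mul_assoc, SchwartzMap.fourierInv_coe]
    rw [integral_fourierInv_mul_poisson hε Q ψ y, SchwartzMap.fourier_coe, hθ']
  simp_rw [hF]
  rw [key]
  exact eG

end PieceRepresentation

/-! ### Borel functional calculus of a representation of `C(X)` -/

section Representation

set_option linter.unusedSectionVars false

open Filter Topology CompactlySupported

/-- Square integrability with respect to `|f|² ν`. -/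
theorem eLpNorm_withDensity_enorm_sq {α : Type*} [MeasurableSpace α] {ν : Measure α} {f g : α → ℂ}
    (hf : AEStronglyMeasurable f ν) (hg : AEStronglyMeasurable g ν) :
    eLpNorm g 2 (ν.withDensity fun t ↦ ‖f t‖ₑ ^ 2) = eLpNorm (g * f) 2 ν := by
  rw [eLpNorm_eq_lintegral_rpow_enorm_toReal (by simp) (by simp),
    eLpNorm_eq_lintegral_rpow_enorm_toReal (by simp) (by simp)]
  congr 1
  rw [lintegral_withDensity_eq_lintegral_mul₀ (by fun_prop) (by fun_prop)]
  refine lintegral_congr fun t ↦ ?_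
  simp [enorm_mul, mul_pow, mul_comm]

variable {H : Type*} [NormedAddCommGroup H] [InnerProductSpace ℂ H] [CompleteSpace H]
variable {X : Type*} [MetricSpace X] [CompactSpace X] [MeasurableSpace X] [BorelSpace X]

/-- A real valued continuous function, regarded as a complex valued one. -/
def ContinuousMap.toComplex (f : C(X, ℝ)) : C(X, ℂ) :=
  ⟨fun t ↦ (f t : ℂ), Complex.continuous_ofReal.comp f.continuous⟩

@[simp] theorem ContinuousMap.toComplex_apply (f : C(X, ℝ)) (t : X) :
    f.toComplex t = (f t : ℂ) := rfl

theorem inner_map_map_eq (ρ : C(X, ℂ) →⋆ₐ[ℂ] (H →L[ℂ] H)) (φ ψ : C(X, ℂ)) (x y : H) :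
    ⟪ρ φ x, ρ ψ y⟫_ℂ = ⟪x, ρ (star φ * ψ) y⟫_ℂ := by
  rw [map_mul, map_star, ContinuousLinearMap.star_eq_adjoint, mul_apply_eq_comp,
    ContinuousLinearMap.adjoint_inner_right]

/-- The positive functional `f ↦ (ρ(f) x, x)` on the real continuous functions. -/
def specFunctional (ρ : C(X, ℂ) →⋆ₐ[ℂ] (H →L[ℂ] H)) (x : H) : C_c(X, ℝ) →ₚ[ℝ] ℝ :=
  PositiveLinearMap.mk₀
    { toFun := fun f ↦ (⟪x, ρ (f : C(X, ℝ)).toComplex x⟫_ℂ).re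
      map_add' := by
        intro f g
        have : ((f + g : C_c(X, ℝ)) : C(X, ℝ)).toComplex
            = (f : C(X, ℝ)).toComplex + (g : C(X, ℝ)).toComplex := by
          ext t; simp
        rw [this, map_add, add_apply, inner_add_right, Complex.add_re]
      map_smul' := by
        intro c f
        have : ((c • f : C_c(X, ℝ)) : C(X, ℝ)).toComplex
            = (c : ℂ) • (f : C(X, ℝ)).toComplex := by
          ext t; simp
        rw [this, map_smul, smul_apply, inner_smul_right,
          Complex.re_ofReal_mul]
        rfl }
    (by
      intro f hf
      let g : C(X, ℂ) := ⟨fun t ↦ (Real.sqrt (f t) : ℂ), by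
        have := f.continuous; fun_prop⟩
      have hg : (f : C(X, ℝ)).toComplex = star g * g := by
        ext t
        have h0 : 0 ≤ f t := hf t
        simp only [ContinuousMap.toComplex_apply, ContinuousMap.mul_apply,
          ContinuousMap.star_apply, g, ContinuousMap.coe_mk, RCLike.star_def, Complex.conj_ofReal]
        rw [← Complex.ofReal_mul, Real.mul_self_sqrt h0]
      change 0 ≤ (⟪x, ρ (f : C(X, ℝ)).toComplex x⟫_ℂ).re
      rw [hg, ← inner_map_map_eq]
      exact inner_self_nonneg (𝕜 := ℂ))

/-- The spectral measure of the vector `x` for the representation `ρ`: the positive measure with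
`∫ φ dμ = (ρ(φ) x, x)` for continuous `φ`. -/
def specMeasure (ρ : C(X, ℂ) →⋆ₐ[ℂ] (H →L[ℂ] H)) (x : H) : Measure X :=
  RealRMK.rieszMeasure (specFunctional ρ x)

variable (ρ : C(X, ℂ) →⋆ₐ[ℂ] (H →L[ℂ] H))

instance (x : H) : (specMeasure ρ x).Regular :=
  inferInstanceAs (RealRMK.rieszMeasure (specFunctional ρ x)).Regular

theorem integral_specMeasure_toComplex (x : H) (f : C(X, ℝ)) :
    ((∫ t, f t ∂(specMeasure ρ x) : ℝ) : ℂ) = ⟪x, ρ f.toComplex x⟫_ℂ := by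
  let f' : C_c(X, ℝ) := ⟨f, HasCompactSupport.of_compactSpace _⟩
  have h := RealRMK.integral_rieszMeasure (specFunctional ρ x) f'
  have h' : (∫ t, f t ∂(specMeasure ρ x) : ℝ) = (⟪x, ρ f.toComplex x⟫_ℂ).re := h
  rw [h']
  have hs : star f.toComplex = f.toComplex := by ext t; simp
  apply Complex.conj_eq_iff_re.1
  rw [inner_conj_symm, ← ContinuousLinearMap.adjoint_inner_right,
    ← ContinuousLinearMap.star_eq_adjoint, ← map_star, hs]

theorem integral_specMeasure (x : H) (φ : C(X, ℂ)) :
    ∫ t, φ t ∂(specMeasure ρ x) = ⟪x, ρ φ x⟫_ℂ := by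
  let a : C(X, ℝ) := ⟨fun t ↦ (φ t).re, by fun_prop⟩
  let b : C(X, ℝ) := ⟨fun t ↦ (φ t).im, by fun_prop⟩
  have hφ : φ = a.toComplex + Complex.I • b.toComplex := by
    ext t
    simp only [ContinuousMap.add_apply, ContinuousMap.smul_apply, ContinuousMap.toComplex_apply, a,
      b, ContinuousMap.coe_mk, smul_eq_mul]
    rw [mul_comm, Complex.re_add_im]
  have h1 : ∫ t, φ t ∂(specMeasure ρ x)
      = ∫ t, ((a t : ℂ) + Complex.I * (b t : ℂ)) ∂(specMeasure ρ x) := by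
    congr 1; ext t
    conv_lhs => rw [hφ]
    simp
  have hi : ∀ c : C(X, ℝ), Integrable (fun t ↦ (c t : ℂ)) (specMeasure ρ x) := fun c ↦
    (c.toComplex.continuous.integrable_of_hasCompactSupport (HasCompactSupport.of_compactSpace _))
  rw [h1, integral_add (hi a) ((hi b).const_mul _), integral_const_mul, integral_complex_ofReal,
    integral_complex_ofReal, integral_specMeasure_toComplex, integral_specMeasure_toComplex]
  conv_rhs => rw [hφ]
  rw [map_add, map_smul, add_apply, inner_add_right,
    smul_apply, inner_smul_right]

theorem specMeasure_univ (x : H) : specMeasure ρ x univ = ENNReal.ofReal (‖x‖ ^ 2) := by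
  have h := integral_specMeasure ρ x 1
  simp only [ContinuousMap.one_apply, integral_const, map_one, one_apply_eq_self,
    inner_self_eq_norm_sq_to_K] at h
  have h2 : (specMeasure ρ x).real univ = ‖x‖ ^ 2 := by
    have h3 : (((specMeasure ρ x).real univ : ℝ) : ℂ) = ((‖x‖ ^ 2 : ℝ) : ℂ) := by
      simpa using h
    exact_mod_cast h3
  rw [← h2, ofReal_measureReal]

/-- The linear map `φ ↦ ρ(φ) x`. -/
def orbitMap (x : H) : C(X, ℂ) →ₗ[ℂ] H where
  toFun φ := ρ φ x
  map_add' _ _ := by simp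
  map_smul' _ _ := by simp

theorem inner_toLp_specMeasure (x : H) (φ ψ : C(X, ℂ)) :
    ⟪ContinuousMap.toLp 2 (specMeasure ρ x) ℂ φ, ContinuousMap.toLp 2 (specMeasure ρ x) ℂ ψ⟫_ℂ
      = ⟪ρ φ x, ρ ψ x⟫_ℂ := by
  rw [ContinuousMap.inner_toLp, inner_map_map_eq, ← integral_specMeasure]
  congr 1; ext t
  simp [mul_comm]

theorem norm_toLp_specMeasure (x : H) (φ : C(X, ℂ)) :
    ‖ContinuousMap.toLp 2 (specMeasure ρ x) ℂ φ‖ = ‖ρ φ x‖ := by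
  rw [norm_eq_sqrt_re_inner (𝕜 := ℂ), norm_eq_sqrt_re_inner (𝕜 := ℂ), inner_toLp_specMeasure]

theorem denseRange_toLp_specMeasure (x : H) :
    DenseRange (ContinuousMap.toLp 2 (specMeasure ρ x) ℂ : C(X, ℂ) →L[ℂ] _) :=
  ContinuousMap.toLp_denseRange ℂ _ ℂ (by simp)

/-- The isometry `L²(μ) → H` that extends `φ ↦ ρ(φ) x`, where `μ` is the spectral measure
of `x`. -/
def specMap (x : H) : Lp ℂ 2 (specMeasure ρ x) →L[ℂ] H :=
  (orbitMap ρ x).extendOfNorm (ContinuousMap.toLp 2 (specMeasure ρ x) ℂ : C(X, ℂ) →L[ℂ] _)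

theorem specMap_toLp (x : H) (φ : C(X, ℂ)) :
    specMap ρ x (ContinuousMap.toLp 2 (specMeasure ρ x) ℂ φ) = ρ φ x :=
  LinearMap.extendOfNorm_eq (denseRange_toLp_specMeasure ρ x)
    ⟨1, fun φ ↦ by rw [one_mul]; exact (norm_toLp_specMeasure ρ x φ).ge⟩ φ

theorem inner_specMap (x : H) (a b : Lp ℂ 2 (specMeasure ρ x)) :
    ⟪specMap ρ x a, specMap ρ x b⟫_ℂ = ⟪a, b⟫_ℂ := by
  refine (denseRange_toLp_specMeasure ρ x).induction_on₂ (p := fun a b ↦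
    ⟪specMap ρ x a, specMap ρ x b⟫_ℂ = ⟪a, b⟫_ℂ) ?_ ?_ a b
  · exact isClosed_eq (by fun_prop) (by fun_prop)
  · intro φ ψ
    rw [specMap_toLp, specMap_toLp, inner_toLp_specMeasure]

open Classical in
/-- The functional calculus: `fcalc ρ f x = f(ρ) x` for `f` in `L²` with respect to the spectral
measure of `x`; the value is `0` otherwise. -/
def fcalc (f : X → ℂ) (x : H) : H :=
  if h : MemLp f 2 (specMeasure ρ x) then specMap ρ x h.toLp else 0

variable {ρ}

theorem fcalc_eq {f : X → ℂ} {x : H} (h : MemLp f 2 (specMeasure ρ x)) :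
    fcalc ρ f x = specMap ρ x h.toLp := dif_pos h

theorem inner_fcalc {f g : X → ℂ} {x : H} (hf : MemLp f 2 (specMeasure ρ x))
    (hg : MemLp g 2 (specMeasure ρ x)) :
    ⟪fcalc ρ f x, fcalc ρ g x⟫_ℂ = ∫ t, star (f t) * g t ∂(specMeasure ρ x) := by
  rw [fcalc_eq hf, fcalc_eq hg, inner_specMap, L2.inner_def]
  refine integral_congr_ae ?_
  filter_upwards [hf.coeFn_toLp, hg.coeFn_toLp] with t h1 h2
  rw [h1, h2]
  simp [mul_comm]

theorem fcalc_add_left {f g : X → ℂ} {x : H} (hf : MemLp f 2 (specMeasure ρ x))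
    (hg : MemLp g 2 (specMeasure ρ x)) : fcalc ρ (f + g) x = fcalc ρ f x + fcalc ρ g x := by
  rw [fcalc_eq hf, fcalc_eq hg, fcalc_eq (hf.add hg), MemLp.toLp_add, map_add]

theorem fcalc_smul_left {f : X → ℂ} {x : H} (c : ℂ) (hf : MemLp f 2 (specMeasure ρ x)) :
    fcalc ρ (c • f) x = c • fcalc ρ f x := by
  rw [fcalc_eq hf, fcalc_eq (hf.const_smul c), MemLp.toLp_const_smul, map_smul]

theorem fcalc_congr_ae {f g : X → ℂ} {x : H} (h : f =ᵐ[specMeasure ρ x] g) :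
    fcalc ρ f x = fcalc ρ g x := by
  by_cases hf : MemLp f 2 (specMeasure ρ x)
  · have hg : MemLp g 2 (specMeasure ρ x) := (memLp_congr_ae h).1 hf
    rw [fcalc_eq hf, fcalc_eq hg]
    congr 1
    exact (MemLp.toLp_eq_toLp_iff hf hg).2 h
  · have hg : ¬ MemLp g 2 (specMeasure ρ x) := fun hg ↦ hf ((memLp_congr_ae h).2 hg)
    rw [fcalc, fcalc, dif_neg hf, dif_neg hg]

theorem ContinuousMap.memLp_specMeasure (φ : C(X, ℂ)) (x : H) :
    MemLp φ 2 (specMeasure ρ x) :=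
  φ.continuous.memLp_of_hasCompactSupport (HasCompactSupport.of_compactSpace _)

theorem fcalc_continuousMap (φ : C(X, ℂ)) (x : H) : fcalc ρ φ x = ρ φ x := by
  rw [fcalc_eq (φ.memLp_specMeasure x), ← specMap_toLp]
  congr 1

theorem tendsto_fcalc {ι : Type*} {l : Filter ι} {f : X → ℂ} {F : ι → X → ℂ} {x : H}
    (hf : MemLp f 2 (specMeasure ρ x)) (hF : ∀ k, MemLp (F k) 2 (specMeasure ρ x))
    (h : Tendsto (fun k ↦ eLpNorm (F k - f) 2 (specMeasure ρ x)) l (𝓝 0)) :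
    Tendsto (fun k ↦ fcalc ρ (F k) x) l (𝓝 (fcalc ρ f x)) := by
  have h1 : Tendsto (fun k ↦ (hF k).toLp) l (𝓝 hf.toLp) := by
    rw [Lp.tendsto_Lp_iff_tendsto_eLpNorm'']
    exact h
  simp_rw [fun k ↦ fcalc_eq (hF k), fcalc_eq hf]
  exact ((specMap ρ x).continuous.tendsto _).comp h1

theorem exists_continuousMap_tendsto_eLpNorm {ν : Measure X} [IsFiniteMeasure ν]
    {f : X → ℂ} (hf : MemLp f 2 ν) : ∃ φ : ℕ → C(X, ℂ),
      Tendsto (fun k ↦ eLpNorm (⇑(φ k) - f) 2 ν) atTop (𝓝 0) := by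
  have h : ∀ k : ℕ, ∃ φ : C(X, ℂ), eLpNorm (⇑φ - f) 2 ν ≤ ((k : ℝ≥0∞) + 1)⁻¹ := by
    intro k
    obtain ⟨g, hg, -⟩ := hf.exists_boundedContinuous_eLpNorm_sub_le (by simp)
      (ε := ((k : ℝ≥0∞) + 1)⁻¹) (by simp)
    refine ⟨g.toContinuousMap, ?_⟩
    rw [eLpNorm_sub_comm]
    exact hg
  choose φ hφ using h
  refine ⟨φ, tendsto_of_tendsto_of_tendsto_of_le_of_le tendsto_const_nhds ?_
    (fun _ ↦ zero_le) hφ⟩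
  have := (ENNReal.tendsto_inv_nat_nhds_zero).comp (tendsto_add_atTop_nat 1)
  refine this.congr fun k ↦ ?_
  simp

theorem memLp_add_measure {ν₁ ν₂ : Measure X} {f : X → ℂ} (h₁ : MemLp f 2 ν₁)
    (h₂ : MemLp f 2 ν₂) : MemLp f 2 (ν₁ + ν₂) := by
  refine ⟨h₁.1.add_measure h₂.1, ?_⟩
  rw [eLpNorm_lt_top_iff_lintegral_rpow_enorm_lt_top (by simp) (by simp), lintegral_add_measure]
  exact ENNReal.add_lt_top.2
    ⟨lintegral_rpow_enorm_lt_top_of_eLpNorm_lt_top (by simp) (by simp) h₁.2,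
    lintegral_rpow_enorm_lt_top_of_eLpNorm_lt_top (by simp) (by simp) h₂.2⟩

/-- The parallelogram law for spectral measures. It bounds the measure of a sum by the measures of
the summands, so that the domain of `f(ρ)` is a linear space. -/
theorem specMeasure_add_add_sub (x y : H) :
    specMeasure ρ (x + y) + specMeasure ρ (x - y)
      = (2 : ℝ≥0∞) • (specMeasure ρ x + specMeasure ρ y) := by
  have : IsFiniteMeasure ((2 : ℝ≥0∞) • (specMeasure ρ x + specMeasure ρ y)) :=
    Measure.smul_finite _ (by simp)
  refine ext_of_forall_integral_eq_of_IsFiniteMeasure fun f ↦ ?_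
  have hi : ∀ z, Integrable f (specMeasure ρ z) := fun z ↦ f.integrable _
  rw [integral_add_measure (hi _) (hi _), integral_smul_measure,
    integral_add_measure (hi _) (hi _)]
  have h := fun z ↦ integral_specMeasure_toComplex ρ z f.toContinuousMap
  apply Complex.ofReal_injective
  have e : ∀ z, (∫ t, f t ∂(specMeasure ρ z)) = ∫ t, f.toContinuousMap t ∂(specMeasure ρ z) :=
    fun z ↦ rfl
  simp only [e, Complex.ofReal_add, smul_eq_mul, Complex.ofReal_mul, h]
  simp only [map_add, map_sub, inner_add_left, inner_add_right, inner_sub_left, inner_sub_right]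
  simp
  ring

theorem specMeasure_add_le (x y : H) :
    specMeasure ρ (x + y) ≤ (2 : ℝ≥0∞) • (specMeasure ρ x + specMeasure ρ y) := by
  rw [← specMeasure_add_add_sub]
  exact Measure.le_add_right le_rfl

theorem specMeasure_smul (c : ℂ) (x : H) :
    specMeasure ρ (c • x) = ENNReal.ofReal (‖c‖ ^ 2) • specMeasure ρ x := by
  have : IsFiniteMeasure (ENNReal.ofReal (‖c‖ ^ 2) • specMeasure ρ x) :=
    Measure.smul_finite _ (by simp)
  refine ext_of_forall_integral_eq_of_IsFiniteMeasure fun f ↦ ?_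
  rw [integral_smul_measure]
  have h := fun z ↦ integral_specMeasure_toComplex ρ z f.toContinuousMap
  apply Complex.ofReal_injective
  have e : ∀ z, (∫ t, f t ∂(specMeasure ρ z)) = ∫ t, f.toContinuousMap t ∂(specMeasure ρ z) :=
    fun z ↦ rfl
  simp only [e, smul_eq_mul, Complex.ofReal_mul, h]
  rw [ENNReal.toReal_ofReal (by positivity), map_smul, inner_smul_left, inner_smul_right,
    ← mul_assoc, ← Complex.normSq_eq_conj_mul_self, Complex.normSq_eq_norm_sq]

theorem memLp_specMeasure_add {f : X → ℂ} {x y : H} (hx : MemLp f 2 (specMeasure ρ x))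
    (hy : MemLp f 2 (specMeasure ρ y)) : MemLp f 2 (specMeasure ρ (x + y)) :=
  ((memLp_add_measure hx hy).smul_measure (by simp)).mono_measure (specMeasure_add_le x y)

theorem memLp_specMeasure_smul {f : X → ℂ} {x : H} (c : ℂ) (hx : MemLp f 2 (specMeasure ρ x)) :
    MemLp f 2 (specMeasure ρ (c • x)) := by
  rw [specMeasure_smul]
  exact hx.smul_measure (by simp)

/-- Additivity in the vector: `f` is approximated by continuous functions in `L²` for the sum of
the spectral measures, so simultaneously for `x`, `y` and `x + y`. -/
theorem fcalc_add_right {f : X → ℂ} {x y : H} (hx : MemLp f 2 (specMeasure ρ x))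
    (hy : MemLp f 2 (specMeasure ρ y)) :
    fcalc ρ f (x + y) = fcalc ρ f x + fcalc ρ f y := by
  obtain ⟨φ, hφ⟩ := exists_continuousMap_tendsto_eLpNorm (memLp_add_measure hx hy)
  have key : ∀ z, MemLp f 2 (specMeasure ρ z) →
      specMeasure ρ z ≤ (2 : ℝ≥0∞) • (specMeasure ρ x + specMeasure ρ y) →
      Tendsto (fun k ↦ ρ (φ k) z) atTop (𝓝 (fcalc ρ f z)) := by
    intro z hz hle
    have := tendsto_fcalc (l := atTop) hz (fun k ↦ (φ k).memLp_specMeasure z) (F := fun k ↦ φ k) ?_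
    · simpa only [fcalc_continuousMap] using this
    · have h2 : Tendsto (fun k ↦ (2 : ℝ≥0∞) ^ (1 / (2 : ℝ≥0∞)).toReal •
          eLpNorm (⇑(φ k) - f) 2 (specMeasure ρ x + specMeasure ρ y)) atTop (𝓝 0) := by
        have := ENNReal.Tendsto.const_mul (a := (2 : ℝ≥0∞) ^ (1 / (2 : ℝ≥0∞)).toReal) hφ
          (Or.inr (by simp))
        simpa using this
      refine tendsto_of_tendsto_of_tendsto_of_le_of_le tendsto_const_nhds h2
        (fun _ ↦ zero_le) fun k ↦ ?_
      refine (eLpNorm_mono_measure _ hle).trans ?_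
      rw [eLpNorm_smul_measure_of_ne_top (by simp)]
  have hle1 : specMeasure ρ x ≤ (2 : ℝ≥0∞) • (specMeasure ρ x + specMeasure ρ y) := by
    rw [two_smul, add_assoc]; exact Measure.le_add_right le_rfl
  have hle2 : specMeasure ρ y ≤ (2 : ℝ≥0∞) • (specMeasure ρ x + specMeasure ρ y) := by
    rw [two_smul, add_comm (specMeasure ρ x), add_assoc]; exact Measure.le_add_right le_rfl
  have h1 := key (x + y) (memLp_specMeasure_add hx hy) (specMeasure_add_le x y)
  simp only [map_add] at h1
  exact tendsto_nhds_unique h1 ((key x hx hle1).add (key y hy hle2))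

theorem fcalc_smul_right {f : X → ℂ} {x : H} (c : ℂ) (hx : MemLp f 2 (specMeasure ρ x)) :
    fcalc ρ f (c • x) = c • fcalc ρ f x := by
  obtain ⟨φ, hφ⟩ := exists_continuousMap_tendsto_eLpNorm hx
  have h1 := tendsto_fcalc hx (fun k ↦ (φ k).memLp_specMeasure x) (F := fun k ↦ φ k) hφ
  have h2 := tendsto_fcalc (l := atTop) (memLp_specMeasure_smul c hx)
    (fun k ↦ (φ k).memLp_specMeasure (c • x)) (F := fun k ↦ φ k) ?_
  · simp only [fcalc_continuousMap, map_smul] at h1 h2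
    exact tendsto_nhds_unique h2 (h1.const_smul c)
  · rw [specMeasure_smul]
    simp_rw [eLpNorm_smul_measure_of_ne_top (show (2 : ℝ≥0∞) ≠ ⊤ by simp)]
    have := ENNReal.Tendsto.const_mul
      (a := (ENNReal.ofReal (‖c‖ ^ 2)) ^ (1 / (2 : ℝ≥0∞)).toReal) hφ
      (Or.inr (ENNReal.rpow_ne_top_of_nonneg (by simp) (by simp)))
    simpa using this

/-- The functional calculus is a module map over the continuous functions. -/
theorem map_fcalc (φ : C(X, ℂ)) {f : X → ℂ} {x : H} (hf : MemLp f 2 (specMeasure ρ x)) :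
    MemLp (⇑φ * f) 2 (specMeasure ρ x) ∧ ρ φ (fcalc ρ f x) = fcalc ρ (⇑φ * f) x := by
  have hb : ∀ g : X → ℂ, ∀ᵐ t ∂(specMeasure ρ x), ‖(⇑φ * g) t‖ ≤ ‖φ‖ * ‖g t‖ := fun g ↦
    Eventually.of_forall fun t ↦ by
      simp only [Pi.mul_apply, norm_mul]
      gcongr
      exact φ.norm_coe_le_norm t
  have hm : ∀ g : X → ℂ, MemLp g 2 (specMeasure ρ x) → MemLp (⇑φ * g) 2 (specMeasure ρ x) :=
    fun g hg ↦ hg.of_le_mul (φ.continuous.aestronglyMeasurable.mul hg.1) (hb g)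
  refine ⟨hm f hf, ?_⟩
  obtain ⟨ψ, hψ⟩ := exists_continuousMap_tendsto_eLpNorm hf
  have h1 := tendsto_fcalc hf (fun k ↦ (ψ k).memLp_specMeasure x) (F := fun k ↦ ψ k) hψ
  have h2 := tendsto_fcalc (l := atTop) (hm f hf) (fun k ↦ (φ * ψ k).memLp_specMeasure x)
    (F := fun k ↦ (φ * ψ k)) ?_
  · simp only [fcalc_continuousMap] at h1
    refine tendsto_nhds_unique (((ρ φ).continuous.tendsto _).comp h1) (h2.congr fun k ↦ ?_)
    rw [fcalc_continuousMap (φ * ψ k), map_mul]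
    rfl
  · have := ENNReal.Tendsto.const_mul (a := ENNReal.ofReal ‖φ‖) hψ (Or.inr (by simp))
    rw [mul_zero] at this
    refine tendsto_of_tendsto_of_tendsto_of_le_of_le tendsto_const_nhds this
      (fun _ ↦ zero_le) fun k ↦ ?_
    have e : ⇑(φ * ψ k) - ⇑φ * f = ⇑φ * (⇑(ψ k) - f) := by
      ext t; simp [mul_sub]
    simp only [e]
    exact eLpNorm_le_mul_eLpNorm_of_ae_le_mul (hb _) 2

/-- The spectral measure of `f(ρ) x` is `|f|² μ` for the spectral measure `μ` of `x`. -/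
theorem specMeasure_fcalc {f : X → ℂ} {x : H} (hf : MemLp f 2 (specMeasure ρ x)) :
    specMeasure ρ (fcalc ρ f x) = (specMeasure ρ x).withDensity fun t ↦ ‖f t‖ₑ ^ 2 := by
  have hfin : IsFiniteMeasure ((specMeasure ρ x).withDensity fun t ↦ ‖f t‖ₑ ^ 2) := by
    refine isFiniteMeasure_withDensity ?_
    have := lintegral_rpow_enorm_lt_top_of_eLpNorm_lt_top (by simp) (by simp) hf.2
    simpa using this.ne
  refine ext_of_forall_integral_eq_of_IsFiniteMeasure fun φ ↦ ?_
  have h := integral_specMeasure_toComplex ρ (fcalc ρ f x) φ.toContinuousMap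
  obtain ⟨h1, h2⟩ := map_fcalc φ.toContinuousMap.toComplex hf
  rw [h2, inner_fcalc hf h1] at h
  apply Complex.ofReal_injective
  refine h.trans ?_
  rw [← integral_complex_ofReal, integral_withDensity_eq_integral_toReal_smul₀]
  · refine integral_congr_ae (Eventually.of_forall fun t ↦ ?_)
    simp only [Pi.mul_apply, ContinuousMap.toComplex_apply, RCLike.star_def,
      ENNReal.toReal_pow, toReal_enorm, Complex.real_smul]
    rw [mul_left_comm, mul_comm ((starRingEnd ℂ) _), Complex.mul_conj, Complex.normSq_eq_norm_sq,
      mul_comm]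
    rfl
  · exact hf.1.enorm.pow_const 2
  · exact Eventually.of_forall fun t ↦ by simp

/-- The functional calculus is multiplicative. -/
theorem fcalc_fcalc {f g : X → ℂ} {x : H} (hf : MemLp f 2 (specMeasure ρ x))
    (hg : Measurable g) (hgf : MemLp (g * f) 2 (specMeasure ρ x)) :
    MemLp g 2 (specMeasure ρ (fcalc ρ f x)) ∧ fcalc ρ g (fcalc ρ f x) = fcalc ρ (g * f) x := by
  have hg2 : MemLp g 2 (specMeasure ρ (fcalc ρ f x)) := by
    refine ⟨hg.aestronglyMeasurable, ?_⟩
    rw [specMeasure_fcalc hf,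
      eLpNorm_withDensity_enorm_sq hf.1 hg.aestronglyMeasurable]
    exact hgf.2
  refine ⟨hg2, ?_⟩
  obtain ⟨φ, hφ⟩ := exists_continuousMap_tendsto_eLpNorm hg2
  have h1 := tendsto_fcalc hg2 (fun k ↦ (φ k).memLp_specMeasure _) (F := fun k ↦ φ k) hφ
  have h2 := tendsto_fcalc (l := atTop) hgf (fun k ↦ (map_fcalc (φ k) hf).1)
    (F := fun k ↦ ⇑(φ k) * f) ?_
  · refine tendsto_nhds_unique h1 (h2.congr fun k ↦ ?_)
    rw [fcalc_continuousMap, (map_fcalc (φ k) hf).2]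
  · refine hφ.congr fun k ↦ ?_
    rw [specMeasure_fcalc hf, eLpNorm_withDensity_enorm_sq hf.1
      ((φ k).continuous.aestronglyMeasurable.sub hg.aestronglyMeasurable), sub_mul]

end Representation

/-! ### The spectral measure of a representation -/

section SpectralMeasureOfRepresentation

set_option linter.unusedSectionVars false

open Filter Topology

/-- Dominated convergence in `L²`. -/
theorem tendsto_eLpNorm_two_of_dominated {α ι : Type*} [MeasurableSpace α] {ν : Measure α}
    {l : Filter ι} [l.IsCountablyGenerated] {f : α → ℂ} {F : ι → α → ℂ} {G : α → ℂ}
    (hf : AEStronglyMeasurable f ν)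
    (hF : ∀ k, AEStronglyMeasurable (F k) ν) (hG : MemLp G 2 ν) (hb : ∀ k t, ‖F k t‖ ≤ ‖G t‖)
    (hfG : ∀ t, ‖f t‖ ≤ ‖G t‖) (hlim : ∀ t, Tendsto (fun k ↦ F k t) l (𝓝 (f t))) :
    Tendsto (fun k ↦ eLpNorm (F k - f) 2 ν) l (𝓝 0) := by
  simp_rw [eLpNorm_eq_lintegral_rpow_enorm_toReal (p := 2) (by simp) (by simp)]
  have h1 : Tendsto (fun k ↦ ∫⁻ t, ‖(F k - f) t‖ₑ ^ (2 : ℝ≥0∞).toReal ∂ν) l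
      (𝓝 (∫⁻ _, 0 ∂ν)) := by
    refine tendsto_lintegral_filter_of_dominated_convergence'
      (fun t ↦ (2 * ‖G t‖ₑ) ^ (2 : ℝ≥0∞).toReal) ?_ ?_ ?_ ?_
    · exact Eventually.of_forall fun k ↦ ((hF k).sub hf).enorm.pow_const _
    · refine Eventually.of_forall fun k ↦ Eventually.of_forall fun t ↦ ?_
      gcongr
      rw [two_mul, Pi.sub_apply]
      refine (enorm_sub_le).trans ?_
      gcongr
      · exact enorm_le_iff_norm_le.2 (hb k t)
      · exact enorm_le_iff_norm_le.2 (hfG t)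
    · simp_rw [ENNReal.mul_rpow_of_nonneg _ _ (ENNReal.toReal_nonneg)]
      rw [lintegral_const_mul' _ _ (by simp)]
      exact ENNReal.mul_ne_top (by simp)
        (lintegral_rpow_enorm_lt_top_of_eLpNorm_lt_top (by simp) (by simp) hG.2).ne
    · refine Eventually.of_forall fun t ↦ ?_
      have h2 : Tendsto (fun k ↦ ‖(F k - f) t‖ₑ) l (𝓝 0) := by
        have := ((hlim t).sub_const (f t)).enorm
        simpa using this
      have := (ENNReal.continuous_rpow_const (y := (2 : ℝ≥0∞).toReal)).tendsto 0
      simpa [Function.comp_def] using this.comp h2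
  have := (ENNReal.continuous_rpow_const (y := 1 / (2 : ℝ≥0∞).toReal)).tendsto 0
  rw [lintegral_zero] at h1
  simpa [Function.comp_def] using this.comp h1

variable {H : Type u} [NormedAddCommGroup H] [InnerProductSpace ℂ H] [CompleteSpace H]

/-- A functional calculus on the real line for the spectral measure `E`: the vector `Φ f x` stands
for `f(A) x`, where `A = ∫ t dE(t)`, and is meaningful when `f` is square integrable with respect
to `(E x, x)`. -/
structure IsCalculus (E : SpectralMeasure H) (Φ : (ℝ → ℂ) → H → H) : Prop where
  scalar_univ : ∀ x, E.scalar x univ = ENNReal.ofReal (‖x‖ ^ 2)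
  inner_eq : ∀ {f g : ℝ → ℂ} {x : H}, MemLp f 2 (E.scalar x) → MemLp g 2 (E.scalar x) →
    ⟪Φ f x, Φ g x⟫_ℂ = ∫ t, star (f t) * g t ∂(E.scalar x)
  one : ∀ x, Φ (fun _ ↦ 1) x = x
  add_left : ∀ {f g : ℝ → ℂ} {x : H}, MemLp f 2 (E.scalar x) → MemLp g 2 (E.scalar x) →
    Φ (f + g) x = Φ f x + Φ g x
  smul_left : ∀ {f : ℝ → ℂ} {x : H} (c : ℂ), MemLp f 2 (E.scalar x) → Φ (c • f) x = c • Φ f x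
  memLp_add : ∀ {f : ℝ → ℂ} {x y : H}, Measurable f → MemLp f 2 (E.scalar x) →
    MemLp f 2 (E.scalar y) → MemLp f 2 (E.scalar (x + y))
  memLp_smul : ∀ {f : ℝ → ℂ} {x : H} (c : ℂ), Measurable f → MemLp f 2 (E.scalar x) →
    MemLp f 2 (E.scalar (c • x))
  add_right : ∀ {f : ℝ → ℂ} {x y : H}, MemLp f 2 (E.scalar x) → MemLp f 2 (E.scalar y) →
    Φ f (x + y) = Φ f x + Φ f y
  smul_right : ∀ {f : ℝ → ℂ} {x : H} (c : ℂ), MemLp f 2 (E.scalar x) → Φ f (c • x) = c • Φ f x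
  scalar_apply : ∀ {f : ℝ → ℂ} {x : H}, Measurable f → MemLp f 2 (E.scalar x) →
    E.scalar (Φ f x) = (E.scalar x).withDensity fun t ↦ ‖f t‖ₑ ^ 2
  comp : ∀ {f g : ℝ → ℂ} {x : H}, MemLp f 2 (E.scalar x) → Measurable g →
    MemLp (g * f) 2 (E.scalar x) → Φ g (Φ f x) = Φ (g * f) x
  tendsto : ∀ {f G : ℝ → ℂ} {F : ℕ → ℝ → ℂ} {x : H}, Measurable f → (∀ k, Measurable (F k)) →
    MemLp G 2 (E.scalar x) → (∀ k t, ‖F k t‖ ≤ ‖G t‖) → (∀ t, ‖f t‖ ≤ ‖G t‖) →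
    (∀ t, Tendsto (fun k ↦ F k t) atTop (𝓝 (f t))) →
    Tendsto (fun k ↦ Φ (F k) x) atTop (𝓝 (Φ f x))

variable {X : Type*} [MetricSpace X] [CompactSpace X] [MeasurableSpace X] [BorelSpace X]
variable (ρ : C(X, ℂ) →⋆ₐ[ℂ] (H →L[ℂ] H)) {τ : X → ℝ}

variable {ρ} in
theorem memLp_indicator_specMeasure {S : Set X} (hS : MeasurableSet S) (x : H) :
    MemLp (S.indicator fun _ ↦ (1 : ℂ)) 2 (specMeasure ρ x) :=
  (memLp_const 1).indicator hS

variable {ρ} in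
theorem fcalc_one (x : H) : fcalc ρ (fun _ ↦ 1) x = x := by
  have := fcalc_continuousMap (ρ := ρ) 1 x
  rw [map_one] at this
  exact this

variable {ρ} in
theorem inner_fcalc_self {f : X → ℂ} {x : H} (hf : MemLp f 2 (specMeasure ρ x)) :
    ⟪x, fcalc ρ f x⟫_ℂ = ∫ t, f t ∂(specMeasure ρ x) := by
  have := inner_fcalc (memLp_const (1 : ℂ)) hf
  rw [fcalc_one] at this
  simpa using this

variable {ρ} in
theorem inner_fcalc_indicator {S : Set X} (hS : MeasurableSet S) (x : H) :
    ⟪x, fcalc ρ (S.indicator fun _ ↦ 1) x⟫_ℂ = ((specMeasure ρ x).real S : ℂ) := by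
  rw [inner_fcalc_self (memLp_indicator_specMeasure hS x), integral_indicator hS]
  simp

variable {ρ} in
theorem norm_fcalc_indicator_sq {S : Set X} (hS : MeasurableSet S) (x : H) :
    ‖fcalc ρ (S.indicator fun _ ↦ 1) x‖ ^ 2 = (specMeasure ρ x).real S := by
  have h := inner_fcalc (memLp_indicator_specMeasure (ρ := ρ) hS x)
    (memLp_indicator_specMeasure hS x)
  have e : ∀ t, star (S.indicator (fun _ ↦ (1 : ℂ)) t) * S.indicator (fun _ ↦ (1 : ℂ)) t
      = S.indicator (fun _ ↦ (1 : ℂ)) t := by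
    intro t; by_cases ht : t ∈ S <;> simp [ht]
  simp_rw [e] at h
  rw [integral_indicator hS, inner_self_eq_norm_sq_to_K] at h
  have h' : ((‖fcalc ρ (S.indicator fun _ ↦ 1) x‖ ^ 2 : ℝ) : ℂ)
      = ((specMeasure ρ x).real S : ℂ) := by simpa using h
  exact_mod_cast h'

/-- The spectral projection of a Borel set. -/
def specProj (S : Set X) (hS : MeasurableSet S) : H →L[ℂ] H :=
  LinearMap.mkContinuous
    { toFun := fun x ↦ fcalc ρ (S.indicator fun _ ↦ 1) x
      map_add' := fun x y ↦
        fcalc_add_right (memLp_indicator_specMeasure hS x) (memLp_indicator_specMeasure hS y)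
      map_smul' := fun c x ↦ fcalc_smul_right c (memLp_indicator_specMeasure hS x) } 1
    (by
      intro x
      rw [one_mul]
      refine (sq_le_sq₀ (norm_nonneg _) (norm_nonneg _)).1 ?_
      have h1 : (specMeasure ρ x).real S ≤ (specMeasure ρ x).real univ :=
        measureReal_mono (subset_univ _)
      rw [measureReal_def (s := univ), specMeasure_univ,
        ENNReal.toReal_ofReal (by positivity)] at h1
      exact (norm_fcalc_indicator_sq hS x).trans_le h1)

theorem specProj_apply {S : Set X} (hS : MeasurableSet S) (x : H) :
    specProj ρ S hS x = fcalc ρ (S.indicator fun _ ↦ 1) x := rfl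

theorem isStarProjection_specProj {S : Set X} (hS : MeasurableSet S) :
    IsStarProjection (specProj ρ S hS) := by
  constructor
  · ext x
    change fcalc ρ _ (fcalc ρ _ x) = fcalc ρ _ x
    have e : (S.indicator fun _ ↦ (1 : ℂ)) * (S.indicator fun _ ↦ (1 : ℂ))
        = S.indicator fun _ ↦ (1 : ℂ) := by
      ext t; by_cases ht : t ∈ S <;> simp [ht]
    have h := fcalc_fcalc (memLp_indicator_specMeasure (ρ := ρ) hS x)
      (measurable_const.indicator hS) (by rw [e]; exact memLp_indicator_specMeasure hS x)
    rw [e] at h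
    exact h.2
  · rw [ContinuousLinearMap.isSelfAdjoint_iff_isSymmetric,
      LinearMap.isSymmetric_iff_inner_map_self_real]
    intro x
    rw [inner_conj_symm]
    change ⟪x, fcalc ρ _ x⟫_ℂ = ⟪fcalc ρ _ x, x⟫_ℂ
    rw [← inner_conj_symm (fcalc ρ _ x) x, inner_fcalc_indicator hS]
    simp

open Classical in
/-- The spectral measure on the line that is the image of the spectral measure of the
representation `ρ` under the Borel function `τ`. -/
def specE (hτ : Measurable τ) : SpectralMeasure H where
  proj S := if hS : MeasurableSet S then specProj ρ (τ ⁻¹' S) (hτ hS) else 0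
  isStarProjection S hS := by
    rw [dif_pos hS]
    exact isStarProjection_specProj ρ (hτ hS)
  proj_univ := by
    ext x
    rw [dif_pos MeasurableSet.univ, specProj_apply]
    simpa using fcalc_one x
  hasSum_proj S hS hd x := by
    rw [dif_pos (MeasurableSet.iUnion hS)]
    simp only [hS, dite_true, specProj_apply]
    have hm := fun i ↦ hτ (hS i)
    have hsum : ∀ F : Finset ℕ, MemLp (∑ i ∈ F, (τ ⁻¹' (S i)).indicator fun _ ↦ (1 : ℂ)) 2
        (specMeasure ρ x) ∧ ∑ i ∈ F, fcalc ρ ((τ ⁻¹' (S i)).indicator fun _ ↦ 1) x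
          = fcalc ρ (∑ i ∈ F, (τ ⁻¹' (S i)).indicator fun _ ↦ 1) x := by
      intro F
      induction F using Finset.induction_on with
      | empty =>
        refine ⟨by simp, ?_⟩
        have := fcalc_smul_left (ρ := ρ) (x := x) 0 (memLp_const (1 : ℂ))
        simp only [Finset.sum_empty]
        simpa using this.symm
      | insert i F hi ih =>
        rw [Finset.sum_insert hi, Finset.sum_insert hi, ih.2]
        exact ⟨(memLp_indicator_specMeasure (hm i) x).add ih.1,
          (fcalc_add_left (memLp_indicator_specMeasure (hm i) x) ih.1).symm⟩
    have hval : ∀ (F : Finset ℕ) (t : X),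
        (∑ i ∈ F, (τ ⁻¹' (S i)).indicator fun _ ↦ (1 : ℂ)) t
          = (⋃ i ∈ F, S i).indicator (fun _ ↦ (1 : ℂ)) (τ t) := by
      intro F t
      rw [Finset.indicator_biUnion_apply F S (fun i _ j _ hij ↦ hd hij), Finset.sum_apply]
      rfl
    have : Tendsto (fun F : Finset ℕ ↦ fcalc ρ (∑ i ∈ F, (τ ⁻¹' (S i)).indicator fun _ ↦ 1) x)
        atTop (𝓝 (fcalc ρ ((τ ⁻¹' (⋃ i, S i)).indicator fun _ ↦ 1) x)) := by
      refine tendsto_fcalc (l := atTop)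
        (memLp_indicator_specMeasure (hτ (MeasurableSet.iUnion hS)) x)
        (fun F ↦ (hsum F).1) (tendsto_eLpNorm_two_of_dominated (G := fun _ ↦ 1)
          (memLp_indicator_specMeasure (hτ (MeasurableSet.iUnion hS)) x).1
          (fun F ↦ (hsum F).1.1) (memLp_const 1) ?_ ?_ ?_)
      · intro F t
        rw [hval]
        exact (norm_indicator_le_norm_self _ _)
      · intro t
        exact (norm_indicator_le_norm_self _ _)
      · intro t
        simp_rw [hval]
        by_cases ht : τ t ∈ ⋃ i, S i
        · obtain ⟨i, hi⟩ := mem_iUnion.1 ht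
          refine tendsto_const_nhds.congr' ?_
          filter_upwards [eventually_ge_atTop {i}] with F hF
          have hiF : i ∈ F := hF (Finset.mem_singleton_self i)
          rw [indicator_of_mem (show t ∈ τ ⁻¹' (⋃ i, S i) from ht),
            indicator_of_mem (mem_iUnion₂.2 ⟨i, hiF, hi⟩)]
        · refine tendsto_const_nhds.congr fun F ↦ ?_
          rw [indicator_of_notMem (show t ∉ τ ⁻¹' (⋃ i, S i) from ht),
            indicator_of_notMem fun h ↦ ht ?_]
          obtain ⟨i, -, hi⟩ := mem_iUnion₂.1 h
          exact mem_iUnion.2 ⟨i, hi⟩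
    exact this.congr fun F ↦ (hsum F).2.symm

theorem scalar_specE (hτ : Measurable τ) (x : H) :
    (specE ρ hτ).scalar x = (specMeasure ρ x).map τ := by
  ext S hS
  rw [Measure.map_apply hτ hS, SpectralMeasure.scalar, Measure.ofMeasurable_apply _ hS]
  simp only [specE, hS, dite_true, specProj_apply]
  rw [inner_fcalc_indicator (hτ hS)]
  simp

theorem isCalculus_specE (hτ : Measurable τ) :
    IsCalculus (specE ρ hτ) fun f x ↦ fcalc ρ (f ∘ τ) x := by
  have hc : ∀ {f : ℝ → ℂ} {x : H}, MemLp f 2 ((specE ρ hτ).scalar x) →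
      MemLp (f ∘ τ) 2 (specMeasure ρ x) := by
    intro f x hf
    rw [scalar_specE] at hf
    exact hf.comp_of_map hτ.aemeasurable
  have hc' : ∀ {f : ℝ → ℂ} {x : H}, Measurable f → MemLp (f ∘ τ) 2 (specMeasure ρ x) →
      MemLp f 2 ((specE ρ hτ).scalar x) := by
    intro f x hf h
    rw [scalar_specE]
    exact (memLp_map_measure_iff hf.aestronglyMeasurable hτ.aemeasurable).2 h
  constructor
  · intro x
    rw [scalar_specE, Measure.map_apply hτ MeasurableSet.univ, preimage_univ, specMeasure_univ]
  · intro f g x hf hg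
    rw [inner_fcalc (hc hf) (hc hg), scalar_specE, integral_map hτ.aemeasurable]
    · rfl
    · rw [← scalar_specE]
      exact hf.1.star.mul hg.1
  · exact fun x ↦ fcalc_one x
  · exact fun hf hg ↦ fcalc_add_left (hc hf) (hc hg)
  · exact fun c hf ↦ fcalc_smul_left c (hc hf)
  · exact fun hm hx hy ↦ hc' hm (memLp_specMeasure_add (hc hx) (hc hy))
  · exact fun c hm hx ↦ hc' hm (memLp_specMeasure_smul c (hc hx))
  · exact fun hx hy ↦ fcalc_add_right (hc hx) (hc hy)
  · exact fun c hx ↦ fcalc_smul_right c (hc hx)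
  · intro f x hm hf
    rw [scalar_specE, scalar_specE, specMeasure_fcalc (hc hf)]
    ext S hS
    rw [Measure.map_apply hτ hS, withDensity_apply _ (hτ hS), withDensity_apply _ hS,
      setLIntegral_map hS (by fun_prop) hτ]
    rfl
  · intro f g x hf hg hgf
    have hgf' := hc hgf
    exact (fcalc_fcalc (hc hf) (hg.comp hτ) (g := g ∘ τ) hgf').2
  · intro f G F x hf hF hG hb hfG hlim
    have hG' := hc hG
    have hm : ∀ {h : ℝ → ℂ}, Measurable h → (∀ t, ‖h t‖ ≤ ‖G t‖) →
        MemLp (h ∘ τ) 2 (specMeasure ρ x) := fun {h} hh hle ↦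
      hG'.mono (hh.comp hτ).aestronglyMeasurable (Eventually.of_forall fun t ↦ hle _)
    exact tendsto_fcalc (F := fun k ↦ F k ∘ τ) (hm hf hfG) (fun k ↦ hm (hF k) (hb k))
      (tendsto_eLpNorm_two_of_dominated (hm hf hfG).1 (fun k ↦ (hm (hF k) (hb k)).1) hG'
        (fun k t ↦ hb k (τ t)) (fun t ↦ hfG (τ t)) fun t ↦ hlim (τ t))

end SpectralMeasureOfRepresentation

/-! ### The spectral theorem for unbounded self-adjoint operators -/

section SpectralTheorem

open Filter Topology
open scoped LinearPMap

variable {H : Type u} [NormedAddCommGroup H] [InnerProductSpace ℂ H] [CompleteSpace H]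

theorem IsSelfAdjoint.inner_pmap_left {A : H →ₗ.[ℂ] H} (hA : IsSelfAdjoint A) (x y : A.domain) :
    ⟪A x, (y : H)⟫_ℂ = ⟪(x : H), A y⟫_ℂ := by
  have h := LinearPMap.adjoint_isFormalAdjoint hA.dense_domain
  rw [LinearPMap.isSelfAdjoint_def.1 hA] at h
  exact h x y

theorem IsSelfAdjoint.im_inner_pmap {A : H →ₗ.[ℂ] H} (hA : IsSelfAdjoint A) (x : A.domain) :
    (⟪(x : H), A x⟫_ℂ).im = 0 := by
  have h := hA.inner_pmap_left x x
  rw [← inner_conj_symm] at h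
  exact Complex.conj_eq_iff_im.1 h

/-- For a self-adjoint operator `A` and a non-real `ζ` the operator `A - ζ` has a bounded
inverse. -/
theorem IsSelfAdjoint.exists_resolvent {A : H →ₗ.[ℂ] H} (hA : IsSelfAdjoint A) {ζ : ℂ}
    (hζ : ζ.im ≠ 0) :
    ∃ R : H →L[ℂ] H, (∀ w, ∃ h : R w ∈ A.domain, A ⟨R w, h⟩ - ζ • R w = w) ∧
      ∀ u : A.domain, R (A u - ζ • (u : H)) = u := by
  have hdense := hA.dense_domain
  have : CompleteSpace A.graph := hA.isClosed.completeSpace_coe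
  -- On the closed graph of `A` the operator `A - ζ` is bounded, bounded below and of dense range.
  let T : A.graph →L[ℂ] H :=
    (ContinuousLinearMap.snd ℂ H H - ζ • ContinuousLinearMap.fst ℂ H H).comp A.graph.subtypeL
  have hT : ∀ u : A.domain, ∀ h, T ⟨((u : H), A u), h⟩ = A u - ζ • (u : H) := fun u h ↦ rfl
  have hmem : ∀ p : A.graph, ∃ u : A.domain, (p : H × H) = ((u : H), A u) := by
    intro p
    obtain ⟨u, h1, h2⟩ := (LinearPMap.mem_graph_iff A).1 p.2
    exact ⟨u, Prod.ext h1.symm h2.symm⟩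
  have hbound : ∀ u : A.domain, |ζ.im| * ‖(u : H)‖ ≤ ‖A u - ζ • (u : H)‖ := by
    intro u
    by_cases hu : (u : H) = 0
    · simp [hu]
    have hu' : 0 < ‖(u : H)‖ := norm_pos_iff.2 hu
    have h1 : (⟪(u : H), A u - ζ • (u : H)⟫_ℂ).im = - ζ.im * ‖(u : H)‖ ^ 2 := by
      rw [inner_sub_right, inner_smul_right, inner_self_eq_norm_sq_to_K, Complex.sub_im,
        hA.im_inner_pmap]
      simp [← Complex.ofReal_pow]
    have h2 := (Complex.abs_im_le_norm _).trans (norm_inner_le_norm (𝕜 := ℂ) (u : H)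
      (A u - ζ • (u : H)))
    rw [h1, abs_mul, abs_neg, abs_of_nonneg (sq_nonneg ‖(u : H)‖)] at h2
    nlinarith
  have hζ' : 0 < |ζ.im| := abs_pos.2 hζ
  have hanti : ∃ c, AntilipschitzWith c T := by
    refine ⟨_, AddMonoidHomClass.antilipschitz_of_bound T
      (K := Real.toNNReal (|ζ.im|⁻¹ + 1 + ‖ζ‖ * |ζ.im|⁻¹)) fun p ↦ ?_⟩
    obtain ⟨⟨p1, p2⟩, hp⟩ := p
    obtain ⟨u, hu⟩ := hmem ⟨_, hp⟩
    simp only [Prod.mk.injEq] at hu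
    obtain ⟨rfl, rfl⟩ := hu
    rw [Real.coe_toNNReal _ (by positivity)]
    change ‖((u : H), A u)‖ ≤ _ * ‖A u - ζ • (u : H)‖
    have h1 := hbound u
    set N := ‖A u - ζ • (u : H)‖
    have h2 : ‖(u : H)‖ ≤ |ζ.im|⁻¹ * N := by
      rw [inv_mul_eq_div, le_div_iff₀ hζ', mul_comm]; exact h1
    have h3 : ‖A u‖ ≤ N + ‖ζ‖ * ‖(u : H)‖ := by
      rw [← norm_smul]
      exact norm_le_norm_sub_add _ _
    have hN : 0 ≤ N := norm_nonneg _
    have h4 : ‖ζ‖ * ‖(u : H)‖ ≤ ‖ζ‖ * (|ζ.im|⁻¹ * N) := by gcongr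
    have h5 : 0 ≤ |ζ.im|⁻¹ * N := by positivity
    have h6 : 0 ≤ ‖ζ‖ * (|ζ.im|⁻¹ * N) := by positivity
    rw [Prod.norm_def]
    refine max_le ?_ ?_ <;> nlinarith
  obtain ⟨c, hc⟩ := hanti
  have hker : T.ker = ⊥ := LinearMap.ker_eq_bot.2 hc.injective
  have hclosed : IsClosed (T.range : Set H) := hc.isClosed_range T.uniformContinuous
  have hrange : T.range = ⊤ := by
    rw [← hclosed.submodule_topologicalClosure_eq, Submodule.topologicalClosure_eq_top_iff,
      Submodule.eq_bot_iff]
    intro y hy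
    have hy1 : ∀ u : A.domain, ⟪(starRingEnd ℂ ζ) • y, (u : H)⟫_ℂ = ⟪y, A u⟫_ℂ := by
      intro u
      have h1 : ⟪A u - ζ • (u : H), y⟫_ℂ = 0 :=
        hy _ ⟨⟨((u : H), A u), LinearPMap.mem_graph A u⟩, rfl⟩
      have h2 : ⟪y, A u - ζ • (u : H)⟫_ℂ = 0 := inner_eq_zero_symm.1 h1
      rw [inner_sub_right, inner_smul_right, sub_eq_zero] at h2
      rw [inner_smul_left, Complex.conj_conj, h2]
    have hyd : y ∈ A†.domain := LinearPMap.mem_adjoint_domain_of_exists y ⟨_, hy1⟩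
    have hval : A† ⟨y, hyd⟩ = (starRingEnd ℂ ζ) • y :=
      LinearPMap.adjoint_apply_eq hdense ⟨y, hyd⟩ hy1
    have hAA := LinearPMap.isSelfAdjoint_def.1 hA
    have hyd' : y ∈ A.domain := by rw [← hAA]; exact hyd
    have hval' : A ⟨y, hyd'⟩ = (starRingEnd ℂ ζ) • y := by
      rw [← hval]
      exact ((LinearPMap.ext_iff.1 hAA).2 (hf := hyd) (hg := hyd')).symm
    have h3 := hA.im_inner_pmap ⟨y, hyd'⟩
    rw [hval', inner_smul_right, inner_self_eq_norm_sq_to_K] at h3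
    simp [← Complex.ofReal_pow, hζ] at h3
    exact h3
  let e := ContinuousLinearEquiv.ofBijective T hker hrange
  have he : ∀ p, e p = T p := fun p ↦ rfl
  have hR : ∀ w, ∃ u : A.domain, ((e.symm w : A.graph) : H × H) = ((u : H), A u) ∧
      A u - ζ • (u : H) = w := by
    intro w
    obtain ⟨u, hu⟩ := hmem (e.symm w)
    refine ⟨u, hu, ?_⟩
    have h1 : T (e.symm w) = w := e.apply_symm_apply w
    have h2 : T (e.symm w) = A u - ζ • (u : H) := by
      change (e.symm w : H × H).2 - ζ • (e.symm w : H × H).1 = _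
      rw [hu]
    rw [← h2, h1]
  refine ⟨(ContinuousLinearMap.fst ℂ H H).comp (A.graph.subtypeL.comp
    (e.symm : H →L[ℂ] A.graph)), fun w ↦ ?_, fun u ↦ ?_⟩
  · obtain ⟨u, hu, h2⟩ := hR w
    have h1 : (ContinuousLinearMap.fst ℂ H H).comp (A.graph.subtypeL.comp
      (e.symm : H →L[ℂ] A.graph)) w = u := congrArg Prod.fst hu
    rw [h1]
    exact ⟨u.2, h2⟩
  · change ((e.symm (A u - ζ • (u : H)) : A.graph) : H × H).1 = u
    have h1 : e ⟨((u : H), A u), LinearPMap.mem_graph A u⟩ = A u - ζ • (u : H) := rfl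
    rw [← h1, e.symm_apply_apply]

/-- The resolvent `R = (A + i)⁻¹` of a self-adjoint operator is normal. The last identity places
its spectrum on the circle that `t ↦ 1 / t - i` maps to the real line. -/
theorem IsSelfAdjoint.exists_normal_resolvent {A : H →ₗ.[ℂ] H} (hA : IsSelfAdjoint A) :
    ∃ R : H →L[ℂ] H, (∀ w, ∃ h : R w ∈ A.domain, A ⟨R w, h⟩ + Complex.I • R w = w) ∧
      (∀ u : A.domain, R (A u + Complex.I • (u : H)) = u) ∧ IsStarNormal R ∧
      star R - R = (2 * Complex.I) • (star R * R) := by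
  obtain ⟨R, hR1, hR2⟩ := hA.exists_resolvent (ζ := -Complex.I) (by simp)
  obtain ⟨S, hS1, hS2⟩ := hA.exists_resolvent (ζ := Complex.I) (by simp)
  simp only [neg_smul, sub_neg_eq_add] at hR1 hR2
  have hstar : star R = S := by
    rw [ContinuousLinearMap.star_eq_adjoint]
    symm
    rw [ContinuousLinearMap.eq_adjoint_iff]
    intro w v
    obtain ⟨hb, hb'⟩ := hR1 v
    obtain ⟨ha, ha'⟩ := hS1 w
    have h := hA.inner_pmap_left ⟨S w, ha⟩ ⟨R v, hb⟩
    conv_lhs => rw [← hb']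
    conv_rhs => rw [← ha']
    rw [inner_add_right, inner_sub_left, inner_smul_right, inner_smul_left, h, Complex.conj_I]
    simp
  refine ⟨R, hR1, hR2, ⟨?_⟩, ?_⟩
  · rw [hstar]
    ext w
    change S (R w) = R (S w)
    obtain ⟨ha, ha'⟩ := hR1 w
    obtain ⟨hp, hp'⟩ := hS1 (R w)
    -- `A` maps `S (R w)` into its domain, so that `A - i` and `A + i` commute on this vector.
    have hAp : A ⟨S (R w), hp⟩ = R w + Complex.I • S (R w) := by
      rw [← sub_eq_iff_eq_add]; exact hp'
    let a : A.domain := ⟨R w, ha⟩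
    let p : A.domain := ⟨S (R w), hp⟩
    have hq : S w = ((a + (2 * Complex.I) • p : A.domain) : H) := by
      rw [← hS2 (a + (2 * Complex.I) • p)]
      congr 1
      rw [LinearPMap.map_add, LinearPMap.map_smul]
      have e1 : A a = w - Complex.I • R w := by rw [eq_sub_iff_add_eq]; exact ha'
      have e2 : A p = R w + Complex.I • S (R w) := hAp
      rw [e1, e2]
      simp only [a, p, Submodule.coe_add, Submodule.coe_smul]
      module
    have hb : A p + Complex.I • (p : H) = S w := by
      rw [hq]
      have e2 : A p = R w + Complex.I • S (R w) := hAp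
      rw [e2]
      simp only [a, p, Submodule.coe_add, Submodule.coe_smul]
      module
    rw [← hb, hR2]
  · refine ContinuousLinearMap.ext fun w ↦ ext_inner_left ℂ fun v ↦ ?_
    obtain ⟨ha, ha'⟩ := hR1 w
    obtain ⟨hb, hb'⟩ := hR1 v
    have h := hA.inner_pmap_left ⟨R v, hb⟩ ⟨R w, ha⟩
    rw [sub_apply, smul_apply, mul_apply_eq_comp, inner_sub_right, inner_smul_right,
      ContinuousLinearMap.star_eq_adjoint, ContinuousLinearMap.adjoint_inner_right,
      ContinuousLinearMap.adjoint_inner_right]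
    conv_lhs => rw [← hb']; enter [1]; rw [← ha']
    rw [hb', inner_add_right, inner_smul_right]
    conv_lhs => enter [2]; rw [← hb']
    rw [inner_add_left, inner_smul_left, h, Complex.conj_I]
    ring

/-- The spectral theorem for an unbounded self-adjoint operator `A`: there is a spectral measure
with a functional calculus in which `A` is the operator of the function `t`. -/
theorem IsSelfAdjoint.exists_isCalculus {A : H →ₗ.[ℂ] H} (hA : IsSelfAdjoint A) :
    ∃ (E : SpectralMeasure H) (Φ : (ℝ → ℂ) → H → H), IsCalculus E Φ ∧
      (∀ x, x ∈ A.domain ↔ MemLp (fun t : ℝ ↦ (t : ℂ)) 2 (E.scalar x)) ∧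
      ∀ x : A.domain, A x = Φ (fun t ↦ (t : ℂ)) x := by
  obtain ⟨R, hR1, hR2, hR3, hR4⟩ := hA.exists_normal_resolvent
  let ρ : C(spectrum ℂ R, ℂ) →⋆ₐ[ℂ] (H →L[ℂ] H) := cfcHom hR3
  let z : C(spectrum ℂ R, ℂ) := (ContinuousMap.id ℂ).restrict <| spectrum ℂ R
  have hz : ρ z = R := cfcHom_id hR3
  have hz' : ∀ t : spectrum ℂ R, z t = t := fun t ↦ rfl
  let τ : spectrum ℂ R → ℝ := fun t ↦ ((t : ℂ)⁻¹ - Complex.I).re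
  have hτ : Measurable τ := by fun_prop
  have hτz : ∀ t : spectrum ℂ R, (t : ℂ) ≠ 0 → (τ t : ℂ) = (t : ℂ)⁻¹ - Complex.I := by
    intro t ht
    have h0 : star z - z - (2 * Complex.I) • (star z * z) = 0 := by
      apply cfcHom_injective hR3
      rw [map_zero]
      change ρ _ = 0
      rw [map_sub, map_sub, map_smul, map_mul, map_star, hz, hR4, sub_self]
    have h1 := DFunLike.congr_fun h0 t
    simp only [ContinuousMap.sub_apply, ContinuousMap.star_apply, ContinuousMap.smul_apply,
      ContinuousMap.mul_apply, ContinuousMap.zero_apply, hz', smul_eq_mul, RCLike.star_def] at h1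
    have ht' : (starRingEnd ℂ) (t : ℂ) ≠ 0 := by simpa using ht
    apply Complex.conj_eq_iff_re.1
    rw [map_sub, map_inv₀, Complex.conj_I]
    field_simp
    linear_combination -h1
  -- The point `0` of the spectrum of `R` carries no mass since `R` is injective.
  have hne : ∀ x, ∀ᵐ t : spectrum ℂ R ∂(specMeasure ρ x), (t : ℂ) ≠ 0 := by
    intro x
    have hm : MeasurableSet {t : spectrum ℂ R | (t : ℂ) = 0} :=
      measurable_subtype_coe (measurableSet_singleton (0 : ℂ))
    have h1 := (map_fcalc z (memLp_indicator_specMeasure (ρ := ρ) hm x)).2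
    have e : ⇑z * ({t : spectrum ℂ R | (t : ℂ) = 0}.indicator fun _ ↦ (1 : ℂ))
        = (0 : ℂ) • fun _ ↦ (1 : ℂ) := by
      ext t
      by_cases ht : (t : ℂ) = 0 <;> simp [hz', ht]
    rw [e, fcalc_smul_left 0 (memLp_const (1 : ℂ)), zero_smul, hz] at h1
    obtain ⟨h, h2⟩ := hR1 (fcalc ρ ({t : spectrum ℂ R | (t : ℂ) = 0}.indicator fun _ ↦ 1) x)
    have h3 : (⟨_, h⟩ : A.domain) = 0 := Subtype.ext h1
    rw [h3, h1, LinearPMap.map_zero] at h2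
    have h4 := norm_fcalc_indicator_sq (ρ := ρ) hm x
    rw [← h2] at h4
    simp only [smul_zero, add_zero, norm_zero, ne_eq, OfNat.ofNat_ne_zero, not_false_eq_true,
      zero_pow] at h4
    rw [ae_iff]
    simp only [ne_eq, not_not]
    exact (measureReal_eq_zero_iff (by finiteness)).1 h4.symm
  have hA1 : ∀ x : A.domain, MemLp (fun t ↦ (τ t : ℂ)) 2 (specMeasure ρ (x : H)) ∧
      fcalc ρ (fun t ↦ (τ t : ℂ)) (x : H) = A x := by
    intro x
    set w := A x + Complex.I • (x : H) with hw
    have hx : (x : H) = fcalc ρ z w := by rw [fcalc_continuousMap, hz, hR2]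
    have hae : (fun t ↦ (τ t : ℂ)) * ⇑z =ᵐ[specMeasure ρ w] (1 - Complex.I • z : C(_, ℂ)) := by
      filter_upwards [hne w] with t ht
      simp only [Pi.mul_apply, hτz t ht, hz', ContinuousMap.sub_apply, ContinuousMap.one_apply,
        ContinuousMap.smul_apply, smul_eq_mul]
      field_simp
    have h := fcalc_fcalc (g := fun t ↦ (τ t : ℂ)) (z.memLp_specMeasure (ρ := ρ) w)
      (by fun_prop) ((memLp_congr_ae hae).2 (ContinuousMap.memLp_specMeasure _ w))
    rw [← hx, fcalc_congr_ae hae, fcalc_continuousMap, map_sub, map_one, map_smul, hz] at h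
    refine ⟨h.1, h.2.trans ?_⟩
    change w - Complex.I • R w = A x
    rw [hw, hR2, add_sub_cancel_right]
  have hmem : ∀ x, MemLp (fun t : ℝ ↦ (t : ℂ)) 2 ((specE ρ hτ).scalar x)
      ↔ MemLp (fun t ↦ (τ t : ℂ)) 2 (specMeasure ρ x) := fun x ↦ by
    rw [scalar_specE, memLp_map_measure_iff (by fun_prop) hτ.aemeasurable]
    rfl
  refine ⟨specE ρ hτ, fun f x ↦ fcalc ρ (f ∘ τ) x, isCalculus_specE ρ hτ, fun x ↦ ?_,
    fun x ↦ (hA1 x).2.symm⟩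
  rw [hmem]
  refine ⟨fun hx ↦ (hA1 ⟨x, hx⟩).1, fun hx ↦ ?_⟩
  have hae : (fun t ↦ (τ t : ℂ)) + (fun _ ↦ Complex.I) =ᵐ[specMeasure ρ x] fun t ↦ (t : ℂ)⁻¹ := by
    filter_upwards [hne x] with t ht
    simp [hτz t ht]
  have hinv : MemLp (fun t : spectrum ℂ R ↦ (t : ℂ)⁻¹) 2 (specMeasure ρ x) :=
    (memLp_congr_ae hae).1 (hx.add (memLp_const _))
  have h := (map_fcalc z hinv).2
  have hae2 : ⇑z * (fun t : spectrum ℂ R ↦ (t : ℂ)⁻¹) =ᵐ[specMeasure ρ x] fun _ ↦ 1 := by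
    filter_upwards [hne x] with t ht
    simp [hz', ht]
  rw [fcalc_congr_ae hae2, fcalc_one, hz] at h
  rw [← h]
  exact (hR1 _).1

/-- The spectral theorem for a bounded self-adjoint operator, with the information that the
continuous functional calculus is the integral with respect to the spectral measure. -/
theorem ContinuousLinearMap.exists_isCalculus {A : H →L[ℂ] H} (hA : IsSelfAdjoint A) :
    ∃ (E : SpectralMeasure H) (Φ : (ℝ → ℂ) → H → H), IsCalculus E Φ ∧
      (∀ x, MemLp (fun t : ℝ ↦ (t : ℂ)) 2 (E.scalar x)) ∧
      (∀ x, A x = Φ (fun t ↦ (t : ℂ)) x) ∧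
      ∀ g : ℝ → ℂ, Continuous g → ∀ x,
        ⟪x, cfc (fun z : ℂ ↦ g z.re) A x⟫_ℂ = ∫ t, g t ∂(E.scalar x) := by
  have hN : IsStarNormal A := hA.isStarNormal
  let ρ : C(spectrum ℂ A, ℂ) →⋆ₐ[ℂ] (H →L[ℂ] H) := cfcHom hN
  let z : C(spectrum ℂ A, ℂ) := (ContinuousMap.id ℂ).restrict <| spectrum ℂ A
  have hz : ρ z = A := cfcHom_id hN
  let τ : spectrum ℂ A → ℝ := fun t ↦ (t : ℂ).re
  have hτ : Measurable τ := by fun_prop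
  have hτz : (fun t ↦ (τ t : ℂ)) = z := by
    ext t
    exact (hA.mem_spectrum_eq_re t.2).symm
  refine ⟨specE ρ hτ, fun f x ↦ fcalc ρ (f ∘ τ) x, isCalculus_specE ρ hτ, fun x ↦ ?_,
    fun x ↦ ?_, fun g hg x ↦ ?_⟩
  · rw [scalar_specE, memLp_map_measure_iff (by fun_prop) hτ.aemeasurable]
    change MemLp (fun t ↦ (τ t : ℂ)) 2 _
    rw [hτz]
    exact z.memLp_specMeasure x
  · change A x = fcalc ρ (fun t ↦ (τ t : ℂ)) x
    rw [hτz, fcalc_continuousMap, hz]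
  · have hgc : ContinuousOn (fun z : ℂ ↦ g z.re) (spectrum ℂ A) := by fun_prop
    rw [cfc_apply _ A hN hgc, scalar_specE, integral_map hτ.aemeasurable (by fun_prop)]
    exact (integral_specMeasure ρ x _).symm

end SpectralTheorem

/-! ### Perturbation of functions of self-adjoint operators -/

section OperatorEstimate

set_option linter.unusedSectionVars false

open Filter Topology

variable {H : Type u} [NormedAddCommGroup H] [InnerProductSpace ℂ H] [CompleteSpace H]

namespace IsCalculus

variable {E : SpectralMeasure H} {Φ : (ℝ → ℂ) → H → H} (hE : IsCalculus E Φ)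

include hE

theorem isFiniteMeasure (x : H) : IsFiniteMeasure (E.scalar x) :=
  ⟨by rw [hE.scalar_univ]; exact ENNReal.ofReal_lt_top⟩

theorem real_univ (x : H) : (E.scalar x).real univ = ‖x‖ ^ 2 := by
  rw [measureReal_def, hE.scalar_univ, ENNReal.toReal_ofReal (by positivity)]

theorem memLp_of_bound {f : ℝ → ℂ} (hf : Measurable f) {C : ℝ} (hC : ∀ t, ‖f t‖ ≤ C) (x : H) :
    MemLp f 2 (E.scalar x) :=
  have := hE.isFiniteMeasure x
  MemLp.of_bound hf.aestronglyMeasurable C (Eventually.of_forall hC)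

theorem inner_self {g : ℝ → ℂ} {x : H} (hg : MemLp g 2 (E.scalar x)) :
    ⟪x, Φ g x⟫_ℂ = ∫ t, g t ∂(E.scalar x) := by
  have h := hE.inner_eq
    (hE.memLp_of_bound (C := 1) (measurable_const (a := (1 : ℂ))) (by simp) x) hg
  rw [hE.one] at h
  simpa using h

theorem norm_sq {f : ℝ → ℂ} {x : H} (hf : MemLp f 2 (E.scalar x)) :
    ‖Φ f x‖ ^ 2 = ∫ t, ‖f t‖ ^ 2 ∂(E.scalar x) := by
  have h := hE.inner_eq hf hf
  have e : ∀ t, star (f t) * f t = ((‖f t‖ ^ 2 : ℝ) : ℂ) := by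
    intro t
    rw [RCLike.star_def, ← Complex.normSq_eq_conj_mul_self, Complex.normSq_eq_norm_sq]
  simp_rw [e] at h
  rw [integral_complex_ofReal, inner_self_eq_norm_sq_to_K] at h
  refine Complex.ofReal_injective (Eq.trans ?_ h)
  simp

theorem memLp_comp {f g : ℝ → ℂ} {x : H} (hfm : Measurable f) (hf : MemLp f 2 (E.scalar x))
    (hg : Measurable g) (hgf : MemLp (g * f) 2 (E.scalar x)) :
    MemLp g 2 (E.scalar (Φ f x)) := by
  refine ⟨hg.aestronglyMeasurable, ?_⟩
  rw [hE.scalar_apply hfm hf, eLpNorm_withDensity_enorm_sq hf.1 hg.aestronglyMeasurable]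
  exact hgf.2

theorem norm_le_of_bound {f : ℝ → ℂ} (hf : Measurable f) {C : ℝ} (hC : ∀ t, ‖f t‖ ≤ C) (x : H) :
    ‖Φ f x‖ ≤ C * ‖x‖ := by
  have := hE.isFiniteMeasure x
  have hC0 : 0 ≤ C := (norm_nonneg _).trans (hC 0)
  refine (sq_le_sq₀ (norm_nonneg _) (by positivity)).1 ?_
  rw [hE.norm_sq (hE.memLp_of_bound hf hC x), mul_pow, ← hE.real_univ, mul_comm,
    ← smul_eq_mul, ← integral_const]
  refine integral_mono_of_nonneg (Eventually.of_forall fun t ↦ by positivity)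
    (integrable_const _) (Eventually.of_forall fun t ↦ ?_)
  exact pow_le_pow_left₀ (norm_nonneg _) (hC t) 2

theorem tendsto_of_bound {f : ℝ → ℂ} (hf : Measurable f) {C : ℝ} (hC : ∀ t, ‖f t‖ ≤ C)
    {v : ℕ → H} {x : H} (hv : Tendsto v atTop (𝓝 x)) :
    Tendsto (fun k ↦ Φ f (v k)) atTop (𝓝 (Φ f x)) := by
  rw [tendsto_iff_norm_sub_tendsto_zero] at hv ⊢
  have h := hv.const_mul C
  rw [mul_zero] at h
  refine squeeze_zero (fun _ ↦ norm_nonneg _) (fun k ↦ ?_) h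
  have e : Φ f (v k) - Φ f x = Φ f (v k - x) := by
    have hm := hE.memLp_of_bound hf hC
    rw [sub_eq_iff_eq_add, ← hE.add_right (hm _) (hm _), sub_add_cancel]
  rw [e]
  exact hE.norm_le_of_bound hf hC _

/-- The operator `∫ g dE`, with its maximal domain. -/
def toPMap (g : ℝ → ℂ) (hg : Measurable g) : H →ₗ.[ℂ] H where
  domain :=
    { carrier := {x | MemLp g 2 (E.scalar x)}
      add_mem' := fun hx hy ↦ hE.memLp_add hg hx hy
      zero_mem' := by
        have h : E.scalar 0 = 0 := by
          rw [← Measure.measure_univ_eq_zero, hE.scalar_univ]; simp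
        simp [h]
      smul_mem' := fun c _ hx ↦ hE.memLp_smul c hg hx }
  toFun :=
    { toFun := fun x ↦ Φ g x
      map_add' := fun x y ↦ hE.add_right x.2 y.2
      map_smul' := fun c x ↦ hE.smul_right c x.2 }

theorem isSpectralIntegral_toPMap (g : ℝ → ℂ) (hg : Measurable g) :
    IsSpectralIntegral E g (hE.toPMap g hg) :=
  ⟨fun _ ↦ Iff.rfl, fun x ↦ hE.inner_self x.2⟩

/-- The operator `∫ g dE` is closed. Multiplication by `q = 1 / (1 + |g|)` reduces this to the
continuity of the bounded operators with symbols `q` and `q g`. -/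
theorem closed {g : ℝ → ℂ} (hg : Measurable g) {v : ℕ → H} {x y : H}
    (hv : ∀ k, MemLp g 2 (E.scalar (v k))) (hx : Tendsto v atTop (𝓝 x))
    (hy : Tendsto (fun k ↦ Φ g (v k)) atTop (𝓝 y)) :
    MemLp g 2 (E.scalar x) ∧ Φ g x = y := by
  -- `p` is the inverse of `q`, by which the membership in the domain of `∫ g dE` is recovered.
  let p : ℝ → ℂ := fun t ↦ ((1 + ‖g t‖ : ℝ) : ℂ)
  let q : ℝ → ℂ := fun t ↦ (((1 + ‖g t‖)⁻¹ : ℝ) : ℂ)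
  have hp : Measurable p := by fun_prop
  have hq : Measurable q := by fun_prop
  have hpq : ∀ t, p t * q t = 1 := fun t ↦ by
    have : 1 + ‖g t‖ ≠ 0 := by positivity
    rw [← Complex.ofReal_mul, mul_inv_cancel₀ this, Complex.ofReal_one]
  have hq1 : ∀ t, ‖q t‖ ≤ 1 := fun t ↦ by
    rw [Complex.norm_real, Real.norm_of_nonneg (by positivity)]
    exact inv_le_one_of_one_le₀ (by linarith [norm_nonneg (g t)])
  have hqg : ∀ t, ‖(q * g) t‖ ≤ 1 := fun t ↦ by
    rw [Pi.mul_apply, norm_mul, Complex.norm_real, Real.norm_of_nonneg (by positivity),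
      inv_mul_eq_div, div_le_one (by positivity)]
    linarith
  have hqgm : Measurable (q * g) := hq.mul hg
  have h1 : Φ q y = Φ (q * g) x := by
    refine tendsto_nhds_unique (hE.tendsto_of_bound hq hq1 hy)
      ((hE.tendsto_of_bound hqgm hqg hx).congr fun k ↦ ?_)
    exact (hE.comp (hv k) hq (hE.memLp_of_bound hqgm hqg _)).symm
  have e1 : p * q = fun _ ↦ (1 : ℂ) := funext hpq
  have e2 : p * (q * g) = g := by
    rw [← mul_assoc, e1]; ext t; simp
  have hy1 : MemLp (p * q) 2 (E.scalar y) := by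
    rw [e1]; exact hE.memLp_of_bound (C := 1) measurable_const (by simp) y
  have hmx := hE.memLp_of_bound hqgm hqg x
  have hmy := hE.memLp_of_bound hq hq1 y
  have hgx : MemLp g 2 (E.scalar x) := by
    refine ⟨hg.aestronglyMeasurable, ?_⟩
    have h2 := (hE.memLp_comp hq hmy hp hy1).2
    rw [h1, hE.scalar_apply hqgm hmx,
      eLpNorm_withDensity_enorm_sq hmx.1 hp.aestronglyMeasurable, e2] at h2
    exact h2
  refine ⟨hgx, ?_⟩
  have h3 := hE.comp hmx hp (by rw [e2]; exact hgx)
  have h4 := hE.comp hmy hp hy1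
  rw [e2, ← h1, h4, e1, hE.one] at h3
  exact h3.symm

/-- The vector `a = (A - ζ)⁻¹ u` for `A = ∫ t dE` and `ζ = s + i ε`; its norm is given by the
Poisson integral of the measure `(E u, u)` since `|t - ζ|⁻² = (π / |ε|) P_{|ε|}(t - s)`. -/
theorem resolvent {s ε : ℝ} (hε : ε ≠ 0) (u : H) :
    ∃ a : H, MemLp (fun t : ℝ ↦ (t : ℂ)) 2 (E.scalar a) ∧
      Φ (fun t ↦ (t : ℂ)) a = u + ((s : ℂ) + ε * Complex.I) • a ∧
      ‖a‖ ^ 2 = Real.pi / |ε| * poissonMeasure |ε| (E.scalar u) s := by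
  let ζ : ℂ := (s : ℂ) + ε * Complex.I
  let r : ℝ → ℂ := fun t ↦ ((t : ℂ) - ζ)⁻¹
  have hr : Measurable r := by fun_prop
  have hn : ∀ t : ℝ, ‖(t : ℂ) - ζ‖ ^ 2 = (t - s) ^ 2 + ε ^ 2 := by
    intro t
    rw [← Complex.normSq_eq_norm_sq, Complex.normSq_apply]
    simp [ζ]
    ring
  have hpos : ∀ t : ℝ, 0 < ‖(t : ℂ) - ζ‖ := fun t ↦ by
    rw [norm_pos_iff]
    intro h
    have := hn t
    rw [h] at this
    have h2 : 0 < ε ^ 2 := by positivity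
    simp at this
    nlinarith [sq_nonneg (t - s)]
  have hrb : ∀ t, ‖r t‖ ≤ |ε|⁻¹ := fun t ↦ by
    rw [norm_inv]
    apply inv_anti₀ (abs_pos.2 hε)
    refine (sq_le_sq₀ (abs_nonneg _) (norm_nonneg _)).1 ?_
    rw [hn, sq_abs]
    nlinarith [sq_nonneg (t - s)]
  have hrL := hE.memLp_of_bound hr hrb u
  have hone := hE.memLp_of_bound (C := 1) (measurable_const (a := (1 : ℂ))) (by simp) u
  have e : (fun t : ℝ ↦ (t : ℂ)) * r = (fun _ ↦ (1 : ℂ)) + ζ • r := by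
    ext t
    have : (t : ℂ) - ζ ≠ 0 := norm_pos_iff.1 (hpos t)
    simp only [Pi.mul_apply, Pi.add_apply, Pi.smul_apply, smul_eq_mul, r]
    field_simp
    ring
  have hid : Measurable fun t : ℝ ↦ (t : ℂ) := by fun_prop
  have hprod : MemLp ((fun t : ℝ ↦ (t : ℂ)) * r) 2 (E.scalar u) := by
    rw [e]; exact hone.add (hrL.const_smul ζ)
  refine ⟨Φ r u, hE.memLp_comp hr hrL hid hprod, ?_, ?_⟩
  · rw [hE.comp hrL hid hprod, e, hE.add_left hone (hrL.const_smul ζ), hE.one,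
      hE.smul_left ζ hrL]
  · rw [hE.norm_sq hrL, poissonMeasure, ← integral_const_mul]
    refine integral_congr_ae (Eventually.of_forall fun t ↦ ?_)
    simp only [r, halfPlaneKernel]
    rw [norm_inv, inv_pow, hn, sq_abs]
    have h2 : 0 < |ε| := abs_pos.2 hε
    have h3 : (t - s) ^ 2 + ε ^ 2 ≠ 0 := by positivity
    field_simp

end IsCalculus

/-- The second resolvent identity, expressed through spectral measures. -/
theorem poissonClose_scalar {A B : H →ₗ.[ℂ] H} {K : H →L[ℂ] H} (hA : IsSelfAdjoint A)
    (hB : IsSelfAdjoint B) (hK : IsBoundedDifference A B K)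
    {E F : SpectralMeasure H} {Φ Ψ : (ℝ → ℂ) → H → H} (hE : IsCalculus E Φ) (hF : IsCalculus F Ψ)
    (hEA : ∀ x, x ∈ A.domain ↔ MemLp (fun t : ℝ ↦ (t : ℂ)) 2 (E.scalar x))
    (hEA' : ∀ x : A.domain, A x = Φ (fun t ↦ (t : ℂ)) x)
    (hFB : ∀ x, x ∈ B.domain ↔ MemLp (fun t : ℝ ↦ (t : ℂ)) 2 (F.scalar x))
    (hFB' : ∀ x : B.domain, B x = Ψ (fun t ↦ (t : ℂ)) x) (u : H) :
    PoissonClose ‖K‖ (E.scalar u) (F.scalar u) := by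
  intro ε hε s
  obtain ⟨a, ha1, ha2, ha3⟩ := hE.resolvent (s := s) (neg_ne_zero.2 hε.ne') u
  obtain ⟨b, hb1, hb2, hb3⟩ := hF.resolvent (s := s) hε.ne' u
  rw [abs_neg, abs_of_pos hε] at ha3
  rw [abs_of_pos hε] at hb3
  have haA : a ∈ A.domain := (hEA a).2 ha1
  have hbB : b ∈ B.domain := (hFB b).2 hb1
  obtain ⟨hbA, hKb⟩ := hK ⟨b, hbB⟩
  rw [← hEA' ⟨a, haA⟩] at ha2
  rw [← hFB' ⟨b, hbB⟩] at hb2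
  have h1 : ⟪a, u⟫_ℂ - ⟪u, b⟫_ℂ = - ⟪a, K b⟫_ℂ := by
    have hu1 : u = A ⟨a, haA⟩ - ((s : ℂ) + (-ε : ℝ) * Complex.I) • a := eq_sub_of_add_eq ha2.symm
    have hu2 : u = B ⟨b, hbB⟩ - ((s : ℂ) + ε * Complex.I) • b := eq_sub_of_add_eq hb2.symm
    have hs := hA.inner_pmap_left ⟨a, haA⟩ ⟨b, hbA⟩
    conv_lhs => enter [1]; rw [hu2]
    conv_lhs => enter [2]; rw [hu1]
    rw [← hKb, inner_sub_right, inner_sub_right, inner_sub_left, inner_smul_left,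
      inner_smul_right, hs]
    simp
  -- The imaginary parts of `(a, u)` and `(u, b)` are Poisson integrals, by symmetry.
  have h2 : (⟪a, u⟫_ℂ).im = ε * ‖a‖ ^ 2 := by
    have hu1 : u = A ⟨a, haA⟩ - ((s : ℂ) + (-ε : ℝ) * Complex.I) • a := eq_sub_of_add_eq ha2.symm
    rw [hu1, inner_sub_right, inner_smul_right, inner_self_eq_norm_sq_to_K, Complex.sub_im,
      hA.im_inner_pmap ⟨a, haA⟩]
    simp [← Complex.ofReal_pow]
  have h3 : (⟪u, b⟫_ℂ).im = ε * ‖b‖ ^ 2 := by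
    have hu2 : u = B ⟨b, hbB⟩ - ((s : ℂ) + ε * Complex.I) • b := eq_sub_of_add_eq hb2.symm
    have h := hB.im_inner_pmap ⟨b, hbB⟩
    rw [← hB.inner_pmap_left] at h
    rw [hu2, inner_sub_left, inner_smul_left, inner_self_eq_norm_sq_to_K, Complex.sub_im, h]
    simp [← Complex.ofReal_pow]
  have h4 : |ε * ‖a‖ ^ 2 - ε * ‖b‖ ^ 2| ≤ ‖K‖ * ((‖a‖ ^ 2 + ‖b‖ ^ 2) / 2) := by
    rw [← h2, ← h3, ← Complex.sub_im, h1]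
    refine (Complex.abs_im_le_norm _).trans ?_
    rw [norm_neg]
    refine (norm_inner_le_norm _ _).trans ?_
    calc ‖a‖ * ‖K b‖ ≤ ‖a‖ * (‖K‖ * ‖b‖) := by gcongr; exact K.le_opNorm b
      _ = ‖K‖ * (‖a‖ * ‖b‖) := by ring
      _ ≤ _ := by gcongr; nlinarith [sq_nonneg (‖a‖ - ‖b‖)]
  rw [ha3, hb3] at h4
  set p := poissonMeasure ε (E.scalar u) s
  set q := poissonMeasure ε (F.scalar u) s
  have e1 : ε * (Real.pi / ε * p) - ε * (Real.pi / ε * q) = Real.pi * (p - q) := by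
    field_simp
  rw [e1, abs_mul, abs_of_pos Real.pi_pos] at h4
  have e2 : ‖K‖ * ((Real.pi / ε * p + Real.pi / ε * q) / 2)
      = Real.pi * (‖K‖ / (2 * ε) * (p + q)) := by
    field_simp
  rw [e2] at h4
  exact le_of_mul_le_mul_left h4 Real.pi_pos

/-- The bound for a function `g` on the line from which operator Lipschitz estimates follow: the
integrals of `g` with respect to `k`-close measures of equal mass `m` differ by at most
`L k m`. -/
def PoissonLipschitz (L : ℝ) (g : ℝ → ℂ) : Prop :=
  ∀ (k : ℝ) (μ ν : Measure ℝ) [IsFiniteMeasure μ] [IsFiniteMeasure ν],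
    μ.real univ = ν.real univ → Integrable (fun t : ℝ ↦ t) μ → Integrable (fun t : ℝ ↦ t) ν →
    PoissonClose k μ ν → ‖∫ t, g t ∂μ - ∫ t, g t ∂ν‖ ≤ L * k * μ.real univ

theorem PoissonLipschitz.norm_sub_le {L : ℝ} {g : ℝ → ℂ} (h : PoissonLipschitz L g) (x y : ℝ) :
    ‖g x - g y‖ ≤ L * |x - y| := by
  have := h _ _ _ (by simp) (integrable_dirac (by simp)) (integrable_dirac (by simp))
    (poissonClose_dirac x y)
  simpa using this

theorem PoissonLipschitz.nonneg {L : ℝ} {g : ℝ → ℂ} (h : PoissonLipschitz L g) : 0 ≤ L := by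
  simpa using (norm_nonneg _).trans (h.norm_sub_le 1 0)

theorem PoissonLipschitz.memLp {L : ℝ} {g : ℝ → ℂ} (h : PoissonLipschitz L g)
    (hg : Measurable g) {μ : Measure ℝ} [IsFiniteMeasure μ]
    (hμ : MemLp (fun t : ℝ ↦ (t : ℂ)) 2 μ) : MemLp g 2 μ := by
  have h1 : MemLp (fun t ↦ g t - g 0) 2 μ := by
    refine hμ.of_le_mul (c := L) (by fun_prop) (Eventually.of_forall fun t ↦ ?_)
    simpa using h.norm_sub_le t 0
  have h2 := h1.add (memLp_const (g 0))
  refine (memLp_congr_ae (Eventually.of_forall fun t ↦ ?_)).1 h2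
  simp

/-- A form bound on a dense subspace bounds the operator, with twice the constant, by
polarization. -/
theorem norm_le_two_mul_of_form_bound {V : Submodule ℂ H} (hV : Dense (V : Set H))
    (D : V →ₗ[ℂ] H) {M : ℝ} (hD : ∀ u : V, ‖⟪(u : H), D u⟫_ℂ‖ ≤ M * ‖(u : H)‖ ^ 2) (u : V) :
    ‖D u‖ ≤ 2 * M * ‖(u : H)‖ := by
  have h1 : ∀ v : V, ‖⟪(v : H), D u⟫_ℂ‖ ≤ M * (‖(u : H)‖ ^ 2 + ‖(v : H)‖ ^ 2) := by
    intro v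
    have e : 4 * ⟪(v : H), D u⟫_ℂ = ⟪((v + u : V) : H), D (v + u)⟫_ℂ
        - ⟪((v - u : V) : H), D (v - u)⟫_ℂ
        - Complex.I * ⟪((v + Complex.I • u : V) : H), D (v + Complex.I • u)⟫_ℂ
        + Complex.I * ⟪((v - Complex.I • u : V) : H), D (v - Complex.I • u)⟫_ℂ := by
      simp only [Submodule.coe_add, Submodule.coe_sub, Submodule.coe_smul, map_add, map_sub,
        map_smul, inner_add_left, inner_add_right, inner_sub_left, inner_sub_right,
        inner_smul_left, inner_smul_right, Complex.conj_I]
      linear_combination (2 * ⟪(v : H), D u⟫_ℂ - 2 * ⟪(u : H), D v⟫_ℂ) * Complex.I_sq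
    have hp := parallelogram_law_with_norm ℂ (v : H) (u : H)
    have hq := parallelogram_law_with_norm ℂ (v : H) (Complex.I • (u : H))
    rw [norm_smul, Complex.norm_I, one_mul] at hq
    have i1 := hD (v + u)
    have i2 := hD (v - u)
    have i3 := hD (v + Complex.I • u)
    have i4 := hD (v - Complex.I • u)
    have n4 : ‖4 * ⟪(v : H), D u⟫_ℂ‖ ≤ M * ‖((v + u : V) : H)‖ ^ 2 + M * ‖((v - u : V) : H)‖ ^ 2
        + M * ‖((v + Complex.I • u : V) : H)‖ ^ 2 + M * ‖((v - Complex.I • u : V) : H)‖ ^ 2 := by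
      rw [e]
      refine (norm_add_le _ _).trans (add_le_add ((norm_sub_le _ _).trans (add_le_add
        ((norm_sub_le _ _).trans (add_le_add i1 i2)) ?_)) ?_)
      · rwa [norm_mul, Complex.norm_I, one_mul]
      · rwa [norm_mul, Complex.norm_I, one_mul]
    simp only [Submodule.coe_add, Submodule.coe_sub, Submodule.coe_smul] at n4
    rw [norm_mul] at n4
    norm_num at n4
    linear_combination (1 / 4) * n4 + (M / 4) * hp + (M / 4) * hq
  have h2 : ∀ v : H, ‖⟪v, D u⟫_ℂ‖ ≤ M * (‖(u : H)‖ ^ 2 + ‖v‖ ^ 2) := by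
    intro v
    refine hV.induction (P := fun v ↦ ‖⟪v, D u⟫_ℂ‖ ≤ M * (‖(u : H)‖ ^ 2 + ‖v‖ ^ 2))
      (fun v hv ↦ h1 ⟨v, hv⟩) ?_ v
    exact isClosed_le (by fun_prop) (by fun_prop)
  by_cases hu : (u : H) = 0
  · have : u = 0 := Subtype.ext hu
    simp [this]
  by_cases hDu : D u = 0
  · have h3 := h2 0
    have hu' : 0 < ‖(u : H)‖ := norm_pos_iff.2 hu
    simp only [inner_zero_left, norm_zero, ne_eq, OfNat.ofNat_ne_zero, not_false_eq_true, zero_pow,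
      add_zero] at h3
    have hM : 0 ≤ M := nonneg_of_mul_nonneg_left h3 (by positivity)
    rw [hDu, norm_zero]
    positivity
  have hu' : 0 < ‖(u : H)‖ := norm_pos_iff.2 hu
  have hDu' : 0 < ‖D u‖ := norm_pos_iff.2 hDu
  -- The vector in the direction of `D u` with the norm of `u`.
  have h3 := h2 (((‖(u : H)‖ / ‖D u‖ : ℝ) : ℂ) • D u)
  rw [inner_smul_left, Complex.conj_ofReal, inner_self_eq_norm_sq_to_K, norm_mul, norm_smul,
    Complex.norm_real, Real.norm_of_nonneg (by positivity), div_mul_cancel₀ _ hDu'.ne'] at h3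
  have e3 : ‖(u : H)‖ / ‖D u‖ * ‖((‖D u‖ : ℂ)) ^ 2‖ = ‖(u : H)‖ * ‖D u‖ := by
    rw [norm_pow, Complex.norm_real, norm_norm]
    field_simp
  have h4 : ‖(u : H)‖ * ‖D u‖ ≤ ‖(u : H)‖ * (2 * M * ‖(u : H)‖) := by
    rw [← e3]
    refine h3.trans (le_of_eq ?_)
    ring
  exact le_of_mul_le_mul_left h4 hu'

/-- The operator Lipschitz estimate for unbounded self-adjoint operators. -/
theorem PoissonLipschitz.exists_isBoundedDifference {L : ℝ} {g : ℝ → ℂ}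
    (hL : PoissonLipschitz L g) (hg : Measurable g)
    {A B : H →ₗ.[ℂ] H} {K : H →L[ℂ] H} (hA : IsSelfAdjoint A)
    (hB : IsSelfAdjoint B) (hK : IsBoundedDifference A B K) :
    ∃ (TA TB : H →ₗ.[ℂ] H) (D : H →L[ℂ] H),
      IsFunctionOf g A TA ∧ IsFunctionOf g B TB ∧ IsBoundedDifference TA TB D ∧
        ‖D‖ ≤ 2 * L * ‖K‖ := by
  obtain ⟨E, Φ, hE, hEA, hEA'⟩ := hA.exists_isCalculus
  obtain ⟨F, Ψ, hF, hFB, hFB'⟩ := hB.exists_isCalculus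
  have hclose := poissonClose_scalar hA hB hK hE hF hEA hEA' hFB hFB'
  have hBA : ∀ u : B.domain, (u : H) ∈ A.domain := fun u ↦ (hK u).1
  have hgE : ∀ u : B.domain, MemLp g 2 (E.scalar (u : H)) := fun u ↦
    have := hE.isFiniteMeasure u
    hL.memLp hg ((hEA u).1 (hBA u))
  have hgF : ∀ u : B.domain, MemLp g 2 (F.scalar (u : H)) := fun u ↦
    have := hF.isFiniteMeasure u
    hL.memLp hg ((hFB u).1 u.2)
  let D₀ : B.domain →ₗ[ℂ] H :=
    { toFun := fun u ↦ Φ g u - Ψ g u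
      map_add' := fun u v ↦ by
        rw [Submodule.coe_add, hE.add_right (hgE u) (hgE v), hF.add_right (hgF u) (hgF v)]
        abel
      map_smul' := fun c u ↦ by
        rw [Submodule.coe_smul, hE.smul_right c (hgE u), hF.smul_right c (hgF u), RingHom.id_apply,
          smul_sub] }
  have hform : ∀ u : B.domain, ‖⟪(u : H), D₀ u⟫_ℂ‖ ≤ L * ‖K‖ * ‖(u : H)‖ ^ 2 := by
    intro u
    have i1 := hE.isFiniteMeasure u
    have i2 := hF.isFiniteMeasure u
    change ‖⟪(u : H), Φ g u - Ψ g u⟫_ℂ‖ ≤ _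
    rw [inner_sub_right, hE.inner_self (hgE u), hF.inner_self (hgF u), ← hE.real_univ]
    have hint : ∀ {μ : Measure ℝ} [IsFiniteMeasure μ], MemLp (fun t : ℝ ↦ (t : ℂ)) 2 μ →
        Integrable (fun t : ℝ ↦ t) μ := fun h ↦ by
      simpa using (h.integrable (by norm_num)).re
    exact hL _ _ _ (by rw [hE.real_univ, hF.real_univ]) (hint ((hEA u).1 (hBA u)))
      (hint ((hFB u).1 u.2)) (hclose u)
  have hbound : ∀ u : B.domain, ‖D₀ u‖ ≤ 2 * L * ‖K‖ * ‖B.domain.subtype u‖ := by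
    intro u
    have := norm_le_two_mul_of_form_bound hB.dense_domain D₀ hform u
    rwa [← mul_assoc] at this
  have hdense : DenseRange B.domain.subtype := by
    simpa [DenseRange] using hB.dense_domain
  let D : H →L[ℂ] H := D₀.extendOfNorm B.domain.subtype
  have hD : ∀ u : B.domain, D u = Φ g u - Ψ g u := fun u ↦
    LinearMap.extendOfNorm_eq hdense ⟨_, hbound⟩ u
  refine ⟨hE.toPMap g hg, hF.toPMap g hg, D, ⟨E, ⟨hEA, fun x ↦ ?_⟩,
    hE.isSpectralIntegral_toPMap g hg⟩, ⟨F, ⟨hFB, fun x ↦ ?_⟩,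
    hF.isSpectralIntegral_toPMap g hg⟩, fun u ↦ ?_, ?_⟩
  · rw [hEA', hE.inner_self ((hEA x).1 x.2)]
  · rw [hFB', hF.inner_self ((hFB x).1 x.2)]
  · -- Approximation of `u` in the graph norm of `g(B)` by vectors with bounded spectral support.
    obtain ⟨u, hu⟩ := u
    have hu' : MemLp g 2 (F.scalar u) := hu
    let c : ℕ → ℝ → ℂ := fun k ↦ (Icc (-(k : ℝ)) k).indicator fun _ ↦ 1
    have hcm : ∀ k, Measurable (c k) := fun k ↦ measurable_const.indicator measurableSet_Icc
    have hc1 : ∀ k t, ‖c k t‖ ≤ 1 := fun k t ↦ by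
      by_cases ht : t ∈ Icc (-(k : ℝ)) k <;> simp [c, ht]
    have hclim : ∀ t, Tendsto (fun k ↦ c k t) atTop (𝓝 1) := fun t ↦ by
      obtain ⟨N, hN⟩ := exists_nat_ge |t|
      refine tendsto_const_nhds.congr' ?_
      filter_upwards [eventually_ge_atTop N] with k hk
      have : |t| ≤ k := hN.trans (by exact_mod_cast hk)
      exact (indicator_of_mem (s := Icc (-(k : ℝ)) k) (abs_le.1 this) fun _ ↦ (1 : ℂ)).symm
    have hcL : ∀ k, MemLp (c k) 2 (F.scalar u) := fun k ↦ hF.memLp_of_bound (hcm k) (hc1 k) u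
    have hid : Measurable fun t : ℝ ↦ (t : ℂ) := by fun_prop
    have htb : ∀ k t, ‖((fun t : ℝ ↦ (t : ℂ)) * c k) t‖ ≤ k := fun k t ↦ by
      by_cases ht : t ∈ Icc (-(k : ℝ)) k
      · simpa [c, ht] using abs_le.2 ht
      · simp [c, ht]
    have hv : ∀ k, Ψ (c k) u ∈ B.domain := fun k ↦ (hFB _).2
      (hF.memLp_comp (hcm k) (hcL k) hid (hF.memLp_of_bound (hid.mul (hcm k)) (htb k) u))
    have hgc : ∀ k t, ‖(g * c k) t‖ ≤ ‖g t‖ := fun k t ↦ by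
      rw [Pi.mul_apply, norm_mul]
      exact mul_le_of_le_one_right (norm_nonneg _) (hc1 k t)
    have hv1 : Tendsto (fun k ↦ Ψ (c k) u) atTop (𝓝 u) := by
      have := hF.tendsto (f := fun _ ↦ 1) (G := fun _ ↦ 1) (x := u) measurable_const hcm
        (hF.memLp_of_bound (C := 1) measurable_const (by simp) u) (by simpa using hc1)
        (fun _ ↦ le_rfl) hclim
      rwa [hF.one] at this
    have hv2 : Tendsto (fun k ↦ Ψ g (Ψ (c k) u)) atTop (𝓝 (Ψ g u)) := by
      have h1 := hF.tendsto (f := g) (G := g) (F := fun k ↦ g * c k) (x := u) hg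
        (fun k ↦ hg.mul (hcm k)) hu' hgc (fun _ ↦ le_rfl)
        (fun t ↦ by simpa using (hclim t).const_mul (g t))
      refine h1.congr fun k ↦ ?_
      exact (hF.comp (hcL k) hg (hu'.mono (hg.mul (hcm k)).aestronglyMeasurable
        (Eventually.of_forall (hgc k)))).symm
    have hv3 : Tendsto (fun k ↦ Φ g (Ψ (c k) u)) atTop (𝓝 (Ψ g u + D u)) := by
      refine (hv2.add ((D.continuous.tendsto u).comp hv1)).congr fun k ↦ ?_
      have := hD ⟨_, hv k⟩
      simp only [Function.comp_apply]
      rw [this, add_sub_cancel]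
    obtain ⟨h1, h2⟩ := hE.closed hg (fun k ↦ hgE ⟨_, hv k⟩) hv1 hv3
    refine ⟨h1, ?_⟩
    change Φ g u - Ψ g u = D u
    rw [h2, add_sub_cancel_left]
  · refine LinearMap.opNorm_extendOfNorm_le hdense ?_ hbound
    have := hL.nonneg
    positivity

/-- The operator Lipschitz estimate for bounded self-adjoint operators. -/
theorem PoissonLipschitz.isOperatorLipschitz {L : ℝ} {g : ℝ → ℂ}
    (hL : PoissonLipschitz L g) (hg : Continuous g) : IsOperatorLipschitz.{u} g := by
  refine ⟨hg, 2 * L, fun H _ _ _ A B hA hB ↦ ?_⟩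
  obtain ⟨E, Φ, hE, hE1, hE2, hE3⟩ := ContinuousLinearMap.exists_isCalculus hA
  obtain ⟨F, Ψ, hF, hF1, hF2, hF3⟩ := ContinuousLinearMap.exists_isCalculus hB
  have hsa : ∀ {T : H →L[ℂ] H}, IsSelfAdjoint T →
      IsSelfAdjoint ((T : H →ₗ[ℂ] H).toPMap ⊤) := fun {T} hT ↦ by
    rw [LinearPMap.isSelfAdjoint_def,
      ContinuousLinearMap.toPMap_adjoint_eq_adjoint_toPMap_of_dense _ (by simp),
      ← ContinuousLinearMap.star_eq_adjoint, hT.star_eq]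
  have hK : IsBoundedDifference ((A : H →ₗ[ℂ] H).toPMap ⊤) ((B : H →ₗ[ℂ] H).toPMap ⊤) (A - B) :=
    fun u ↦ ⟨trivial, rfl⟩
  have hclose := poissonClose_scalar (hsa hA) (hsa hB) hK hE hF (fun x ↦ ⟨fun _ ↦ hE1 x,
    fun _ ↦ trivial⟩) (fun x ↦ hE2 x) (fun x ↦ ⟨fun _ ↦ hF1 x, fun _ ↦ trivial⟩) fun x ↦ hF2 x
  set D := cfc (fun z : ℂ ↦ g z.re) A - cfc (fun z : ℂ ↦ g z.re) B with hDdef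
  refine D.opNorm_le_bound (mul_nonneg (mul_nonneg zero_le_two hL.nonneg) (norm_nonneg _))
    fun x ↦ ?_
  have hform : ∀ u : (⊤ : Submodule ℂ H), ‖⟪(u : H), (D : H →ₗ[ℂ] H).domRestrict ⊤ u⟫_ℂ‖
      ≤ L * ‖A - B‖ * ‖(u : H)‖ ^ 2 := by
    rintro ⟨u, -⟩
    have i1 := hE.isFiniteMeasure u
    have i2 := hF.isFiniteMeasure u
    change ‖⟪u, cfc (fun z : ℂ ↦ g z.re) A u - cfc (fun z : ℂ ↦ g z.re) B u⟫_ℂ‖ ≤ _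
    rw [inner_sub_right, hE3 g hg, hF3 g hg, ← hE.real_univ]
    have hint : ∀ {μ : Measure ℝ} [IsFiniteMeasure μ], MemLp (fun t : ℝ ↦ (t : ℂ)) 2 μ →
        Integrable (fun t : ℝ ↦ t) μ := fun h ↦ by
      simpa using (h.integrable (by norm_num)).re
    exact hL _ _ _ (by rw [hE.real_univ, hF.real_univ]) (hint (hE1 u)) (hint (hF1 u)) (hclose u)
  have := norm_le_two_mul_of_form_bound (V := ⊤) (by simp) _ hform ⟨x, trivial⟩
  rwa [← mul_assoc] at this

end OperatorEstimate

/-! ### Representation of the Besov class -/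

section Primitive

open Filter Topology

/-- A Schwartz function of mean zero is the derivative of a Schwartz function: because of the
vanishing mean the primitive is `∫_{-∞}^x ψ = -∫_x^∞ ψ`, which decays rapidly at both ends. -/
theorem SchwartzMap.exists_derivCLM_eq (ψ : 𝓢(ℝ, ℂ)) (hψ : ∫ x, ψ x = 0) :
    ∃ Ψ : 𝓢(ℝ, ℂ), SchwartzMap.derivCLM ℂ ℂ Ψ = ψ := by
  let F : ℝ → ℂ := fun x ↦ ∫ t in Iic x, ψ t
  have hF : ∀ x, HasDerivAt F (ψ x) x := by
    intro x
    have h1 : F = fun x ↦ F 0 + ∫ t in (0 : ℝ)..x, ψ t := by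
      funext x
      rw [← intervalIntegral.integral_Iic_sub_Iic ψ.integrable.integrableOn
        ψ.integrable.integrableOn]
      simp [F]
    rw [h1]
    exact (intervalIntegral.integral_hasDerivAt_right (ψ.continuous.intervalIntegrable _ _)
      (ψ.continuous.stronglyMeasurableAtFilter _ _) ψ.continuous.continuousAt).const_add _
  have hd : deriv F = ψ := funext fun x ↦ (hF x).deriv
  have hF' : ∀ x, F x = -∫ t in Ioi x, ψ t := by
    intro x
    have := intervalIntegral.integral_Iic_add_Ioi (b := x) (μ := volume) (f := ψ)
      ψ.integrable.integrableOn ψ.integrable.integrableOn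
    rw [hψ] at this
    exact eq_neg_of_add_eq_zero_left this
  refine ⟨⟨F, contDiff_infty_iff_deriv.2 ⟨fun x ↦ (hF x).differentiableAt, hd ▸ ψ.smooth'⟩,
    fun k n ↦ ?_⟩, ?_⟩
  · cases n with
    | zero =>
      have hi : Integrable fun t : ℝ ↦ ‖t‖ ^ k * ‖ψ t‖ := ψ.integrable_pow_mul volume k
      have hbound : ∀ (x : ℝ) (S : Set ℝ), MeasurableSet S → (∀ t ∈ S, ‖x‖ ≤ ‖t‖) →
          ‖x‖ ^ k * ‖∫ t in S, ψ t‖ ≤ ∫ t, ‖t‖ ^ k * ‖ψ t‖ := by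
        intro x S hS hx
        calc ‖x‖ ^ k * ‖∫ t in S, ψ t‖ ≤ ‖x‖ ^ k * ∫ t in S, ‖ψ t‖ := by
              gcongr; exact norm_integral_le_integral_norm _
          _ = ∫ t in S, ‖x‖ ^ k * ‖ψ t‖ := (integral_const_mul _ _).symm
          _ ≤ ∫ t in S, ‖t‖ ^ k * ‖ψ t‖ := by
              refine setIntegral_mono_on (ψ.integrable.norm.const_mul _).integrableOn
                hi.integrableOn hS fun t ht ↦ ?_
              gcongr
              exact hx t ht
          _ ≤ ∫ t, ‖t‖ ^ k * ‖ψ t‖ :=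
              setIntegral_le_integral hi (Eventually.of_forall fun t ↦ by positivity)
      refine ⟨∫ t, ‖t‖ ^ k * ‖ψ t‖, fun x ↦ ?_⟩
      rw [norm_iteratedFDeriv_zero]
      rcases le_total x 0 with h | h
      · refine hbound x _ measurableSet_Iic fun t ht ↦ ?_
        rw [Real.norm_eq_abs, Real.norm_eq_abs, abs_of_nonpos h, abs_of_nonpos (ht.trans h)]
        exact neg_le_neg ht
      · rw [hF', norm_neg]
        refine hbound x _ measurableSet_Ioi fun t ht ↦ ?_
        rw [Real.norm_eq_abs, Real.norm_eq_abs, abs_of_nonneg h, abs_of_nonneg (h.trans ht.le)]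
        exact ht.le
    | succ n =>
      obtain ⟨C, -, hC⟩ := ψ.decay k n
      refine ⟨C, fun x ↦ ?_⟩
      rw [norm_iteratedFDeriv_eq_norm_iteratedDeriv, iteratedDeriv_succ', hd,
        ← norm_iteratedFDeriv_eq_norm_iteratedDeriv]
      exact hC x
  · ext x
    rw [SchwartzMap.derivCLM_apply]
    exact congrFun hd x

end Primitive

section PoissonSeries

open Filter Topology

/-- The sum of the Poisson integrals of the functions `φ n` at heights `2⁻ⁿ`, each normalized to
vanish at `0`. -/
def poissonSeries (φ : ℤ → ℝ → ℂ) (x : ℝ) : ℂ :=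
  ∑' n : ℤ, (poissonIntegral ((2 : ℝ) ^ (-n)) (φ n) x - poissonIntegral ((2 : ℝ) ^ (-n)) (φ n) 0)

variable {φ : ℤ → ℝ → ℂ} {a : ℤ → ℝ} {L : ℝ}

theorem norm_poissonIntegral_two_zpow_sub_le (hφ : ∀ n, Measurable (φ n))
    (ha : ∀ n s, ‖φ n s‖ ≤ a n) (n : ℤ) (x y : ℝ) :
    ‖poissonIntegral ((2 : ℝ) ^ (-n)) (φ n) x - poissonIntegral ((2 : ℝ) ^ (-n)) (φ n) y‖
      ≤ (2 : ℝ) ^ n * a n * |x - y| := by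
  have h := norm_poissonIntegral_sub_le (ε := (2 : ℝ) ^ (-n)) (by positivity) (hφ n) (ha n) x y
  rwa [zpow_neg, div_inv_eq_mul, mul_comm (a n), ← zpow_neg] at h

theorem hasSum_poissonSeries (hφ : ∀ n, Measurable (φ n)) (ha : ∀ n s, ‖φ n s‖ ≤ a n)
    (hL : HasSum (fun n ↦ (2 : ℝ) ^ n * a n) L) (x : ℝ) :
    HasSum (fun n ↦ poissonIntegral ((2 : ℝ) ^ (-n)) (φ n) x
      - poissonIntegral ((2 : ℝ) ^ (-n)) (φ n) 0) (poissonSeries φ x) :=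
  (Summable.of_norm_bounded (hL.summable.mul_right |x - 0|) fun n ↦
    norm_poissonIntegral_two_zpow_sub_le hφ ha n x 0).hasSum

theorem norm_poissonSeries_sub_le (hφ : ∀ n, Measurable (φ n)) (ha : ∀ n s, ‖φ n s‖ ≤ a n)
    (hL : HasSum (fun n ↦ (2 : ℝ) ^ n * a n) L) (x y : ℝ) :
    ‖poissonSeries φ x - poissonSeries φ y‖ ≤ L * |x - y| := by
  have h := (hasSum_poissonSeries hφ ha hL x).sub (hasSum_poissonSeries hφ ha hL y)
  refine h.norm_le_of_bounded (hL.mul_right |x - y|) fun n ↦ ?_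
  rw [sub_sub_sub_cancel_right]
  exact norm_poissonIntegral_two_zpow_sub_le hφ ha n x y

theorem continuous_poissonSeries (hφ : ∀ n, Measurable (φ n)) (ha : ∀ n s, ‖φ n s‖ ≤ a n)
    (hL : HasSum (fun n ↦ (2 : ℝ) ^ n * a n) L) : Continuous (poissonSeries φ) :=
  (LipschitzWith.of_dist_le' (K := L) fun x y ↦ by
    rw [dist_eq_norm, dist_eq_norm]
    exact norm_poissonSeries_sub_le hφ ha hL x y).continuous

theorem norm_poissonSeries_le (hφ : ∀ n, Measurable (φ n)) (ha : ∀ n s, ‖φ n s‖ ≤ a n)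
    (hL : HasSum (fun n ↦ (2 : ℝ) ^ n * a n) L) (x : ℝ) : ‖poissonSeries φ x‖ ≤ L * |x| := by
  have h := norm_poissonSeries_sub_le hφ ha hL x 0
  have h0 : poissonSeries φ 0 = 0 := by simp [poissonSeries]
  simpa [h0] using h

/-- The series can be integrated term by term against a weight with a finite first moment. -/
theorem integral_mul_poissonSeries (hφ : ∀ n, Measurable (φ n)) (ha : ∀ n s, ‖φ n s‖ ≤ a n)
    (hL : HasSum (fun n ↦ (2 : ℝ) ^ n * a n) L) {μ : Measure ℝ} {ψ : ℝ → ℂ}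
    (hψ : AEStronglyMeasurable ψ μ) (hi : Integrable (fun x ↦ |x| * ‖ψ x‖) μ) :
    Integrable (fun x ↦ ψ x * poissonSeries φ x) μ ∧
      (∀ n, Integrable (fun x ↦ ψ x * (poissonIntegral ((2 : ℝ) ^ (-n)) (φ n) x
        - poissonIntegral ((2 : ℝ) ^ (-n)) (φ n) 0)) μ) ∧
      HasSum (fun n ↦ ∫ x, ψ x * (poissonIntegral ((2 : ℝ) ^ (-n)) (φ n) x
        - poissonIntegral ((2 : ℝ) ^ (-n)) (φ n) 0) ∂μ) (∫ x, ψ x * poissonSeries φ x ∂μ) := by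
  have hm : ∀ n, AEStronglyMeasurable (fun x ↦ ψ x * (poissonIntegral ((2 : ℝ) ^ (-n)) (φ n) x
        - poissonIntegral ((2 : ℝ) ^ (-n)) (φ n) 0)) μ := fun n ↦
    hψ.mul ((continuous_poissonIntegral (by positivity) (hφ n) (ha n)).sub
      continuous_const).aestronglyMeasurable
  have hb : ∀ n x, ‖ψ x * (poissonIntegral ((2 : ℝ) ^ (-n)) (φ n) x
        - poissonIntegral ((2 : ℝ) ^ (-n)) (φ n) 0)‖ ≤ (2 : ℝ) ^ n * a n * (|x| * ‖ψ x‖) := by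
    intro n x
    have h := norm_poissonIntegral_two_zpow_sub_le hφ ha n x 0
    rw [sub_zero] at h
    rw [norm_mul, mul_comm ‖ψ x‖, ← mul_assoc]
    exact mul_le_mul_of_nonneg_right h (norm_nonneg _)
  refine ⟨?_, fun n ↦ ?_, ?_⟩
  · refine (hi.const_mul L).mono' (hψ.mul (continuous_poissonSeries hφ ha hL).aestronglyMeasurable)
      (Eventually.of_forall fun x ↦ ?_)
    have h := norm_poissonSeries_le hφ ha hL x
    rw [norm_mul, mul_comm ‖ψ x‖, ← mul_assoc]
    exact mul_le_mul_of_nonneg_right h (norm_nonneg _)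
  · exact (hi.const_mul _).mono' (hm n) (Eventually.of_forall (hb n))
  · refine hasSum_integral_of_dominated_convergence
      (fun n x ↦ (2 : ℝ) ^ n * a n * (|x| * ‖ψ x‖)) hm (fun n ↦ Eventually.of_forall (hb n))
      (Eventually.of_forall fun x ↦ hL.summable.mul_right _) ?_
      (Eventually.of_forall fun x ↦ (hasSum_poissonSeries hφ ha hL x).mul_left _)
    simp_rw [tsum_mul_right]
    exact hi.const_mul _

/-- The series inherits the estimate `(k / 2⁻ⁿ) ‖φ n‖_∞` of its terms; the normalizing constants
cancel since the measures have equal mass. -/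
theorem poissonLipschitz_const_add_poissonSeries (hφ : ∀ n, Measurable (φ n))
    (ha : ∀ n s, ‖φ n s‖ ≤ a n) (hL : HasSum (fun n ↦ (2 : ℝ) ^ n * a n) L) (c : ℂ) :
    PoissonLipschitz L (fun x ↦ c + poissonSeries φ x) := by
  intro k μ ν _ _ hm iμ iν hk
  have hmom : ∀ (ρ : Measure ℝ), Integrable (fun t : ℝ ↦ t) ρ →
      Integrable (fun x ↦ |x| * ‖(1 : ℂ)‖) ρ := fun ρ h ↦ by simpa using h.abs
  obtain ⟨jμ, jμn, sμ⟩ := integral_mul_poissonSeries hφ ha hL (ψ := fun _ ↦ 1)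
    aestronglyMeasurable_const (hmom μ iμ)
  obtain ⟨jν, jνn, sν⟩ := integral_mul_poissonSeries hφ ha hL (ψ := fun _ ↦ 1)
    aestronglyMeasurable_const (hmom ν iν)
  simp only [one_mul] at jμ jμn sμ jν jνn sν
  rw [integral_add (integrable_const c) jμ, integral_add (integrable_const c) jν, integral_const,
    integral_const, hm, add_sub_add_left_eq_sub, ← hm]
  have h2 : HasSum (fun n ↦ (2 : ℝ) ^ n * a n * (k * μ.real univ)) (L * (k * μ.real univ)) :=
    hL.mul_right _
  rw [mul_assoc]
  refine (sμ.sub sν).norm_le_of_bounded h2 fun n ↦ ?_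
  have hε : (0 : ℝ) < 2 ^ (-n) := by positivity
  rw [integral_sub (integral_poissonIntegral hε (hφ n) (ha n) μ).1 (integrable_const _),
    integral_sub (integral_poissonIntegral hε (hφ n) (ha n) ν).1 (integrable_const _),
    integral_const, integral_const, hm, sub_sub_sub_cancel_right, ← hm]
  refine (hk.norm_integral_sub_le hm hε (hφ n) (ha n)).trans (le_of_eq ?_)
  rw [zpow_neg, div_inv_eq_mul]
  ring

end PoissonSeries

section BesovRepresentation

open Filter Topology

/-- A distribution whose derivative is the sum of the derivatives of the Poisson integrals
`u_n` agrees with their normalized sum up to a constant. -/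
theorem exists_represents_const_add_poissonSeries {φ : ℤ → ℝ → ℂ} {a : ℤ → ℝ} {L : ℝ}
    (hφ : ∀ n, Measurable (φ n)) (ha : ∀ n s, ‖φ n s‖ ≤ a n)
    (hL : HasSum (fun n ↦ (2 : ℝ) ^ n * a n) L) {S : ℤ → 𝓢'(ℝ, ℂ)} {f : 𝓢'(ℝ, ℂ)}
    (hS : ∀ n, Represents (poissonIntegral ((2 : ℝ) ^ (-n)) (φ n)) (S n))
    (hf : HasSum (fun n ↦ TemperedDistribution.derivCLM ℂ (S n))
      (TemperedDistribution.derivCLM ℂ f)) :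
    ∃ c : ℂ, Represents (fun x ↦ c + poissonSeries φ x) f := by
  have hmom : ∀ ψ : 𝓢(ℝ, ℂ), Integrable fun x : ℝ ↦ |x| * ‖ψ x‖ := fun ψ ↦ by
    simpa using ψ.integrable_pow_mul volume 1
  have hint : ∀ ψ : 𝓢(ℝ, ℂ), Integrable fun x ↦ ψ x * poissonSeries φ x := fun ψ ↦
    (integral_mul_poissonSeries hφ ha hL ψ.continuous.aestronglyMeasurable (hmom ψ)).1
  have hzero : ∀ ψ : 𝓢(ℝ, ℂ), ∫ x, ψ x = 0 → f ψ = ∫ x, ψ x * poissonSeries φ x := by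
    intro ψ h0
    obtain ⟨Ψ, hΨ⟩ := ψ.exists_derivCLM_eq h0
    have h1 := (hf.mapL (PointwiseConvergenceCLM.evalCLM (RingHom.id ℂ) ℂ Ψ)).neg
    have e : ∀ T : 𝓢'(ℝ, ℂ), -(PointwiseConvergenceCLM.evalCLM (RingHom.id ℂ) ℂ Ψ
        (TemperedDistribution.derivCLM ℂ T)) = T ψ := fun T ↦ by
      change -(TemperedDistribution.derivCLM ℂ T Ψ) = T ψ
      rw [TemperedDistribution.derivCLM_apply_apply, hΨ, map_neg, neg_neg]
    have h2 : HasSum (fun n ↦ S n ψ) (f ψ) := by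
      simp only [e] at h1
      exact h1
    refine h2.unique ?_
    have h3 := (integral_mul_poissonSeries hφ ha hL ψ.continuous.aestronglyMeasurable
      (hmom ψ)).2.2
    refine h3.congr_fun fun n ↦ ?_
    simp_rw [mul_sub]
    rw [integral_sub (hS n ψ).1 (ψ.integrable.mul_const _), integral_mul_const, h0, zero_mul,
      sub_zero, (hS n ψ).2]
  let v : ContDiffBump (0 : ℝ) := ⟨1, 2, by norm_num, by norm_num⟩
  let θ : 𝓢(ℝ, ℂ) := HasCompactSupport.toSchwartzMap
    (f := fun x ↦ ((v.normed volume x : ℝ) : ℂ))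
    (v.hasCompactSupport_normed.comp_left Complex.ofReal_zero)
    (Complex.ofRealCLM.contDiff.comp v.contDiff_normed)
  have hθ : ∫ x, θ x = 1 := by
    change ∫ x, ((v.normed volume x : ℝ) : ℂ) = 1
    rw [integral_complex_ofReal, v.integral_normed, Complex.ofReal_one]
  refine ⟨f θ - ∫ x, θ x * poissonSeries φ x, fun ψ ↦ ⟨?_, ?_⟩⟩
  · simp_rw [mul_add]
    exact (ψ.integrable.mul_const _).add (hint ψ)
  · have h := hzero (ψ - (∫ x, ψ x) • θ) (by
      simp only [sub_apply, smul_apply, smul_eq_mul]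
      rw [integral_sub ψ.integrable (θ.integrable.const_mul _), integral_const_mul, hθ, mul_one,
        sub_self])
    rw [map_sub, map_smul, smul_eq_mul, sub_eq_iff_eq_add] at h
    rw [h]
    simp only [sub_apply, smul_apply, smul_eq_mul, sub_mul, mul_add,
      mul_assoc]
    rw [integral_sub (hint ψ) ((hint θ).const_mul _), integral_add (ψ.integrable.mul_const _)
      (hint ψ), integral_const_mul, integral_mul_const]
    ring

theorem Represents.unique {g g' : ℝ → ℂ} (hg : Continuous g) (hg' : Continuous g')
    {f : 𝓢'(ℝ, ℂ)} (h : Represents g f) (h' : Represents g' f) : g = g' := by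
  have hz : ∀ᵐ x : ℝ, (g - g') x = 0 := by
    refine ae_eq_zero_of_integral_contDiff_smul_eq_zero (hg.sub hg').locallyIntegrable
      fun χ hχ hc ↦ ?_
    let ψ : 𝓢(ℝ, ℂ) := HasCompactSupport.toSchwartzMap (f := fun x ↦ ((χ x : ℝ) : ℂ))
      (hc.comp_left Complex.ofReal_zero) (Complex.ofRealCLM.contDiff.comp hχ)
    have e : ∀ x, χ x • (g - g') x = ψ x * g x - ψ x * g' x := by
      intro x
      change χ x • (g x - g' x) = (χ x : ℂ) * g x - (χ x : ℂ) * g' x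
      rw [← mul_sub, Complex.real_smul]
    simp_rw [e]
    rw [integral_sub (h ψ).1 (h' ψ).1, ← (h ψ).2, ← (h' ψ).2, sub_self]
  refine (Continuous.ae_eq_iff_eq volume hg hg').1 ?_
  filter_upwards [hz] with x hx
  exact sub_eq_zero.1 hx

theorem toReal_two_zpow (n : ℤ) : ((2 : ℝ≥0∞) ^ n).toReal = (2 : ℝ) ^ n := by
  cases n <;> simp [zpow_negSucc]

/-- The functions of the Besov class are continuous and satisfy the estimate `PoissonLipschitz`
with a constant that is an absolute multiple of the norm. -/
theorem exists_poissonLipschitz_of_memBesov : ∃ C₀ : ℝ, ∀ w : ℝ → ℝ, IsDyadicWindow w →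
    ∀ f : 𝓢'(ℝ, ℂ), MemBesov w f → ∃ g : ℝ → ℂ, Continuous g ∧ Represents g f ∧
      PoissonLipschitz (C₀ * (besovNorm w f).toReal) g := by
  obtain ⟨C₀, -, hC⟩ := exists_poissonIntegral_representation
  refine ⟨C₀, fun w hw f hf ↦ ?_⟩
  have htop := hf.norm_ne_top
  unfold besovNorm at htop
  have hfin : ∀ n, linftyNorm (littlewoodPaley w n f) ≠ ⊤ := fun n h ↦ by
    refine ENNReal.ne_top_of_tsum_ne_top htop n ?_
    rw [h, ENNReal.mul_top]
    exact (ENNReal.zpow_pos (by norm_num) (by norm_num) n).ne'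
  choose φ hφ hbd hrep using fun n ↦ hC w hw f n (hfin n)
  have hL : HasSum (fun n : ℤ ↦ (2 : ℝ) ^ n * (C₀ * (linftyNorm (littlewoodPaley w n f)).toReal))
      (C₀ * (besovNorm w f).toReal) := by
    have h := (ENNReal.hasSum_toReal htop).mul_left C₀
    rw [← ENNReal.tsum_toReal_eq (ENNReal.ne_top_of_tsum_ne_top htop)] at h
    refine h.congr_fun fun n ↦ ?_
    rw [ENNReal.toReal_mul, toReal_two_zpow]
    ring
  obtain ⟨c, hc⟩ := exists_represents_const_add_poissonSeries hφ hbd hL hrep hf.hasSum_deriv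
  exact ⟨_, continuous_const.add (continuous_poissonSeries hφ hbd hL), hc,
    poissonLipschitz_const_add_poissonSeries hφ hbd hL c⟩

end BesovRepresentation

end

/-! ### The theorem -/

theorem theorem1p6p1 :
    ∃ C : ℝ, ∀ w : ℝ → ℝ, IsDyadicWindow w → ∀ f : 𝓢'(ℝ, ℂ), MemBesov w f →
      (∃ g : ℝ → ℂ, Continuous g ∧ Represents g f) ∧
      ∀ g : ℝ → ℂ, Continuous g → Represents g f →
        IsOperatorLipschitz.{u} g ∧
        ∀ (H : Type u) [NormedAddCommGroup H] [InnerProductSpace ℂ H] [CompleteSpace H]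
          (A B : H →ₗ.[ℂ] H) (K : H →L[ℂ] H),
          IsSelfAdjoint A → IsSelfAdjoint B → IsBoundedDifference A B K →
          ∃ (TA TB : H →ₗ.[ℂ] H) (D : H →L[ℂ] H),
            IsFunctionOf g A TA ∧ IsFunctionOf g B TB ∧ IsBoundedDifference TA TB D ∧
            ‖D‖ ≤ C * (besovNorm w f).toReal * ‖K‖ := by
  obtain ⟨C₀, hC₀⟩ := exists_poissonLipschitz_of_memBesov
  refine ⟨2 * C₀, fun w hw f hf ↦ ?_⟩
  obtain ⟨g₀, hg₀, hrep, hL⟩ := hC₀ w hw f hf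
  refine ⟨⟨g₀, hg₀, hrep⟩, fun g hg hgf ↦ ?_⟩
  obtain rfl := hrep.unique hg₀ hg hgf
  refine ⟨hL.isOperatorLipschitz hg, fun H _ _ _ A B K hA hB hK ↦ ?_⟩
  rw [mul_assoc 2]
  exact hL.exists_isBoundedDifference hg.measurable hA hB hK
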